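/- Let $n\ge 2$, let $\Omega=\{x\in\mathbb{R}^n : x_1^2+\dots+x_{n-1}^2<x_n^2\}$ be the open Euclidean double cone, $X=\overline{\Omega}$ its closure with Lebesgue measure $\lambda$, and $r(x)=|x|$. Functions are real valued and identified when they agree $\lambda$-a.e. Let $W^1_p(\Omega)$ be the Sobolev space of $f\in L^p(\Omega)$ whose distributional gradient $\nabla f$ on $\Omega$ lies in $L^p(\Omega)$, with norm $\|f\|_{W^1_p(\Omega)}=\|f\|_{L^p(\Omega)}+\|\,|\nabla f|\,\|_{L^p(\Omega)}$. Let $H^1_1(X)$ be the completion for the norm of $W^1_1(\Omega)$ (that is, the closure in $W^1_1(\Omega)$) of the space of compactly supported Lipschitz functions on $X$, let $H^1_\infty(X)=\operatorname{Lip}(X)\cap L^\infty(X)$, and for $p\in\{1,\infty\}$ let $$\widetilde H^1_p(X)=\{f\in H^1_p(X) : f/r\in L^p(X)\},\qquad \|f\|_{\widetilde H^1_p(X)}=\|f\|_{W^1_p(\Omega)}+\|f/r\|_{L^p(\Omega)}.$$ For $f\in\widetilde H^1_1(X)+\widetilde H^1_\infty(X)$ and $t>0$ let $$K(f,t,\widetilde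 H^1_1,\widetilde H^1_\infty)=\inf\{\|f_0\|_{\widetilde H^1_1(X)}+t\|f_1\|_{\widetilde H^1_\infty(X)} : f=f_0+f_1,\ f_0\in\widetilde H^1_1(X),\ f_1\in\widetilde H^1_\infty(X)\}.$$ For a measurable function $g$ on $X$ let $g^*(t)=\inf\{a\ge 0 : \lambda(\{|g|>a\})\le t\}$ for $t\ge 0$ and $g^{**}(t)=\frac1t\int_0^t g^*(s)\,ds$ for $t>0$. Theorem. There are constants $c,C>0$, depending only on $n$, such that for every $f\in\widetilde H^1_1(X)+\widetilde H^1_\infty(X)$ and every $t>0$, $$c\,t\Big(f^{**}(t)+\Big(\frac{|f|}{r}\Big)^{**}(t)+|\nabla f|^{**}(t)\Big)\le K(f,t,\widetilde H^1_1,\widetilde H^1_\infty)\le C\,t\Big(f^{**}(t)+\Big(\frac{|f|}{r}\Big)^{**}(t)+|\nabla f|^{**}(t)\Big).$$ -/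

import Mathlib

open Set Filter Topology MeasureTheory
open scoped ENNReal NNReal ContDiff

noncomputable section

/-! ## The double cone in `ℝⁿ`, with `n = d + 1` -/

/-- The open Euclidean double cone `x₁² + ⋯ + xₙ₋₁² < xₙ²` in `ℝⁿ`, where `n = d + 1`. -/
def doubleCone (d : ℕ) : Set (EuclideanSpace ℝ (Fin (d + 1))) :=
  {x | ∑ i : Fin d, x i.castSucc ^ 2 < x (Fin.last d) ^ 2}

/-- The closed double cone `X`, the closure of `Ω`. -/
def closedDoubleCone (d : ℕ) : Set (EuclideanSpace ℝ (Fin (d + 1))) :=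
  closure (doubleCone d)

/-- Lebesgue measure on the double cone. Functions on `Ω` or on `X` are represented by functions on
`ℝⁿ` whose values matter only up to null sets of this measure (`X \ Ω` is a Lebesgue null set). -/
def coneMeasure (d : ℕ) : Measure (EuclideanSpace ℝ (Fin (d + 1))) :=
  volume.restrict (doubleCone d)

/-! ## Distributional gradients and the Sobolev space `W¹_p(Ω)` -/

/-- `G` is the gradient of `f` on `Ω` in the sense of distributions. -/
structure HasWeakGradient {d : ℕ} (f : EuclideanSpace ℝ (Fin (d + 1)) → ℝ)
    (G : EuclideanSpace ℝ (Fin (d + 1)) → EuclideanSpace ℝ (Fin (d + 1))) : Prop where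
  locallyIntegrable_fun : LocallyIntegrableOn f (doubleCone d) volume
  locallyIntegrable_grad : LocallyIntegrableOn G (doubleCone d) volume
  integral_eq : ∀ φ : EuclideanSpace ℝ (Fin (d + 1)) → ℝ, ContDiff ℝ ∞ φ → HasCompactSupport φ →
    tsupport φ ⊆ doubleCone d → ∀ i : Fin (d + 1),
      ∫ x in doubleCone d, f x * fderiv ℝ φ x (EuclideanSpace.single i 1)
        = - ∫ x in doubleCone d, G x i * φ x

open Classical in
/-- The distributional gradient `∇f` on `Ω` (unique up to a.e. equality when it exists as a locally
integrable function; the zero field otherwise). -/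
def weakGradient {d : ℕ} (f : EuclideanSpace ℝ (Fin (d + 1)) → ℝ) :
    EuclideanSpace ℝ (Fin (d + 1)) → EuclideanSpace ℝ (Fin (d + 1)) :=
  if h : ∃ G, HasWeakGradient f G then h.choose else 0

/-- `f ∈ W¹_p(Ω)`: `f` and its distributional gradient belong to `L^p(Ω)`. -/
def MemW1 {d : ℕ} (p : ℝ≥0∞) (f : EuclideanSpace ℝ (Fin (d + 1)) → ℝ) : Prop :=
  MemLp f p (coneMeasure d) ∧ ∃ G, HasWeakGradient f G ∧ MemLp G p (coneMeasure d)

/-- The norm `‖f‖_{L^p(Ω)} + ‖ |∇f| ‖_{L^p(Ω)}`. -/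
def normW1 {d : ℕ} (p : ℝ≥0∞) (f : EuclideanSpace ℝ (Fin (d + 1)) → ℝ) : ℝ≥0∞ :=
  eLpNorm f p (coneMeasure d) + eLpNorm (weakGradient f) p (coneMeasure d)

/-! ## The spaces `H¹_p(X)` and `H̃¹_p(X)` -/

/-- `f` is Lipschitz on `X`. -/
def LipschitzOnCone {d : ℕ} (f : EuclideanSpace ℝ (Fin (d + 1)) → ℝ) : Prop :=
  ∃ K : ℝ≥0, LipschitzWith K ((closedDoubleCone d).domRestrict f)

/-- `f ∈ Lip₀(X)`: `f` is Lipschitz on `X`, with compact support in `X`. -/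
def MemLipZero {d : ℕ} (f : EuclideanSpace ℝ (Fin (d + 1)) → ℝ) : Prop :=
  LipschitzOnCone f ∧ HasCompactSupport ((closedDoubleCone d).domRestrict f)

/-- `f ∈ H¹_p(X)`. For `p < ∞` this is the completion of `Lip₀(X)` in the norm of `W¹_p(Ω)`, realized
as its closure in the Banach space `W¹_p(Ω)`; for `p = ∞` it is `Lip(X) ∩ L^∞(X)`. -/
def MemH1 {d : ℕ} (p : ℝ≥0∞) (f : EuclideanSpace ℝ (Fin (d + 1)) → ℝ) : Prop :=
  if p = ⊤ then
    ∃ g, f =ᵐ[coneMeasure d] g ∧ LipschitzOnCone g ∧ ∃ B : ℝ, ∀ x ∈ closedDoubleCone d, |g x| ≤ B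
  else
    MemW1 p f ∧ ∀ ε : ℝ≥0∞, 0 < ε → ∃ g, MemLipZero g ∧ normW1 p (fun x => f x - g x) ≤ ε

/-- `f ∈ H̃¹_p(X)`: `f ∈ H¹_p(X)` and `f / r ∈ L^p(X)`, where `r x = |x|`. -/
def MemTildeH1 {d : ℕ} (p : ℝ≥0∞) (f : EuclideanSpace ℝ (Fin (d + 1)) → ℝ) : Prop :=
  MemH1 p f ∧ MemLp (fun x => f x / ‖x‖) p (coneMeasure d)

/-- The norm `‖f‖_{W¹_p(Ω)} + ‖f / r‖_{L^p(Ω)}` of `H̃¹_p(X)`. -/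
def normTildeH1 {d : ℕ} (p : ℝ≥0∞) (f : EuclideanSpace ℝ (Fin (d + 1)) → ℝ) : ℝ≥0∞ :=
  normW1 p f + eLpNorm (fun x => f x / ‖x‖) p (coneMeasure d)

/-- `f ∈ H̃¹_1(X) + H̃¹_∞(X)`. -/
def MemSumTildeH1 {d : ℕ} (f : EuclideanSpace ℝ (Fin (d + 1)) → ℝ) : Prop :=
  ∃ f₀ f₁, MemTildeH1 1 f₀ ∧ MemTildeH1 ⊤ f₁ ∧ f =ᵐ[coneMeasure d] fun x => f₀ x + f₁ x

/-- Peetre's functional `K(f, t, H̃¹_1, H̃¹_∞)`: the infimum of `‖f₀‖_{H̃¹_1} + t ‖f₁‖_{H̃¹_∞}` over all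
decompositions `f = f₀ + f₁` with `f₀ ∈ H̃¹_1(X)` and `f₁ ∈ H̃¹_∞(X)`. -/
def kFunctionalTildeH1 {d : ℕ} (f : EuclideanSpace ℝ (Fin (d + 1)) → ℝ) (t : ℝ) : ℝ≥0∞ :=
  ⨅ (f₀ : EuclideanSpace ℝ (Fin (d + 1)) → ℝ) (f₁ : EuclideanSpace ℝ (Fin (d + 1)) → ℝ)
    (_ : MemTildeH1 1 f₀) (_ : MemTildeH1 ⊤ f₁)
    (_ : f =ᵐ[coneMeasure d] fun x => f₀ x + f₁ x),
      normTildeH1 1 f₀ + ENNReal.ofReal t * normTildeH1 ⊤ f₁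

/-! ## Rearrangements -/

/-- The decreasing rearrangement `f*(t) = inf {a ≥ 0 : μ {|f| > a} ≤ t}` of `f`, for `t ≥ 0`. -/
def decreasingRearrangement {α : Type*} [MeasurableSpace α] (μ : Measure α) (f : α → ℝ)
    (t : ℝ) : ℝ≥0∞ :=
  sInf {a : ℝ≥0∞ | μ {x | a < ‖f x‖ₑ} ≤ ENNReal.ofReal t}

/-- The maximal decreasing rearrangement `f**(t) = (1/t) ∫₀ᵗ f*(s) ds` of `f`, for `t > 0`. -/
def maximalRearrangement {α : Type*} [MeasurableSpace α] (μ : Measure α) (f : α → ℝ)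
    (t : ℝ) : ℝ≥0∞ :=
  (ENNReal.ofReal t)⁻¹ * ∫⁻ s in Ioc 0 t, decreasingRearrangement μ f s

end

/-!
The couple `(H̃¹₁, H̃¹_∞)` behaves like `(L¹, L^∞)`: its `K`-functional is comparable to the sum of
the `K`-functionals `t f**(t)`, `t (|f|/r)**(t)` and `t |∇f|**(t)` of `f`, `f / r` and `∇f`.

The lower bound needs only the subadditivity `t g**(t) ≤ ‖u‖₁ + t ‖v‖_∞` for `|g| ≤ |u| + |v|`
(`ofReal_mul_maximalRearrangement_le`) and the uniqueness of weak gradients.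

For the upper bound, fix a height `l` above the three maximal rearrangements. The good set
consists of the Lebesgue points of `f` in `Ω` at which `|f| ≤ l`, `|f| ≤ l r` and the maximal
function of `(|∇f| - l)₊` is at most `l`; by the Vitali covering lemma (`mul_measure_maximalSet_le`)
its complement has measure at most a multiple of `t`. On the good set `f` is Lipschitz with a
constant comparable to `l`. The two halves of the cone are convex, and inside one half two points
`x` and `y` are compared with the average of `f` over a ball of size `|x - y|` contained in that half:
moving along rays from `x` to the ball costs at most `|x - y|` times the maximal function of `∇f`
at `x` (`HasWeakGradient.abs_integral_mul_sub_le`). The halves meet only at the vertex, where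
Poincaré's inequality breaks down, and points of different halves are compared through `|f| ≤ l r`;
this is what the weight `1 / r` is for. Extend `f` from the good set to a Lipschitz function and
truncate it at the height `l min(1, r)`. The result `f₁` belongs to `H̃¹_∞` with norm comparable to
`l`, and `f₀ = f - f₁` vanishes on the good set.

The gradient of `f₀` vanishes there too (`HasWeakGradient.ae_eq_zero_of_eq_zero`): `f₀` is a limit
of Lipschitz functions `v`, and the functions `ε arctan (v / ε)` are uniformly small while their
gradients approach the restriction of `∇f₀` to `{f₀ = 0}`. So `f₀`, `f₀ / r` and `∇f₀` are
integrated over a set of measure at most a multiple of `t` only, which gives norm at most a multiple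
of `t l`. Finally `f₀` lies in the closure `H¹₁` of the compactly supported Lipschitz functions
(`MemW1.memH1_of_ae_eq_add`), because it differs by a bounded Lipschitz function from the summand
in `H¹₁` that is given with `f`, and bounded Lipschitz functions in `W¹₁` can be cut off at infinity.
-/

noncomputable section

/-! ### Rearrangements -/

section Rearrangement

variable {α : Type*} [MeasurableSpace α] {μ : Measure α}

/-- The layer cake formula for functions with values in `ℝ≥0∞`. -/
theorem lintegral_eq_lintegral_meas_ofReal_lt [SFinite μ] {g : α → ℝ≥0∞} (hg : AEMeasurable g μ) :
    ∫⁻ x, g x ∂μ = ∫⁻ a in Ioi (0 : ℝ), μ {x | ENNReal.ofReal a < g x} := by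
  wlog hm : Measurable g generalizing g
  · have h := this hg.measurable_mk.aemeasurable hg.measurable_mk
    rw [lintegral_congr_ae hg.ae_eq_mk, h]
    refine lintegral_congr fun a => measure_congr ?_
    filter_upwards [hg.ae_eq_mk] with x hx
    exact congrArg (ENNReal.ofReal a < ·) hx.symm
  have hlen (c : ℝ≥0∞) :
      c = ∫⁻ a in Ioi (0 : ℝ), {a : ℝ | ENNReal.ofReal a < c}.indicator 1 a := by
    rw [lintegral_indicator_one (measurableSet_lt ENNReal.measurable_ofReal measurable_const),
      Measure.restrict_apply (measurableSet_lt ENNReal.measurable_ofReal measurable_const)]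
    rcases eq_or_ne c ⊤ with rfl | hc
    · simp
    · have : {a : ℝ | ENNReal.ofReal a < c} ∩ Ioi 0 = Ioo 0 c.toReal := by
        ext a
        refine ⟨fun h => ⟨h.2, ?_⟩, fun h => ⟨?_, h.1⟩⟩
        · exact (ENNReal.ofReal_lt_iff_lt_toReal (le_of_lt h.2) hc).1 h.1
        · exact (ENNReal.ofReal_lt_iff_lt_toReal h.1.le hc).2 h.2
      rw [this, Real.volume_Ioo, sub_zero, ENNReal.ofReal_toReal hc]
  have hS : MeasurableSet {p : α × ℝ | ENNReal.ofReal p.2 < g p.1} :=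
    measurableSet_lt (ENNReal.measurable_ofReal.comp measurable_snd) (hm.comp measurable_fst)
  calc ∫⁻ x, g x ∂μ
      = ∫⁻ x, (∫⁻ a in Ioi (0 : ℝ),
          {p : α × ℝ | ENNReal.ofReal p.2 < g p.1}.indicator (1 : α × ℝ → ℝ≥0∞) (x, a)) ∂μ :=
        lintegral_congr fun x => hlen (g x)
    _ = ∫⁻ a in Ioi (0 : ℝ), ∫⁻ x,
          {p : α × ℝ | ENNReal.ofReal p.2 < g p.1}.indicator (1 : α × ℝ → ℝ≥0∞) (x, a) ∂μ :=
        lintegral_lintegral_swap (measurable_one.indicator hS).aemeasurable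
    _ = _ := by
        refine lintegral_congr fun a => ?_
        have hs : MeasurableSet {x | ENNReal.ofReal a < g x} := measurableSet_lt measurable_const hm
        rw [← lintegral_indicator_one hs]
        rfl

theorem antitone_decreasingRearrangement (μ : Measure α) (f : α → ℝ) :
    Antitone (decreasingRearrangement μ f) := fun _ _ hst =>
  sInf_le_sInf fun _ ha => le_trans ha (ENNReal.ofReal_le_ofReal hst)

theorem ofReal_lt_measure_of_lt_decreasingRearrangement {f : α → ℝ} {s : ℝ} {a : ℝ≥0∞}
    (h : a < decreasingRearrangement μ f s) : ENNReal.ofReal s < μ {x | a < ‖f x‖ₑ} := by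
  by_contra! hle
  have : decreasingRearrangement μ f s ≤ a := sInf_le hle
  exact absurd this (not_le.2 h)

theorem le_decreasingRearrangement_of_ofReal_lt_measure {f : α → ℝ} {s : ℝ} {a : ℝ≥0∞}
    (h : ENNReal.ofReal s < μ {x | a < ‖f x‖ₑ}) : a ≤ decreasingRearrangement μ f s := by
  refine le_sInf fun b hb => ?_
  by_contra! hba
  exact absurd (h.trans_le ((measure_mono fun x hx => lt_trans hba hx).trans hb)) (lt_irrefl _)

/-- The rearrangement of `u` over `(0, ∞)` has at most the integral of `|u|`. -/
theorem lintegral_decreasingRearrangement_le [SFinite μ] {u : α → ℝ} (hu : AEMeasurable u μ) :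
    ∫⁻ s in Ioi (0 : ℝ), decreasingRearrangement μ u s ≤ ∫⁻ x, ‖u x‖ₑ ∂μ := by
  rw [lintegral_eq_lintegral_meas_ofReal_lt hu.enorm, lintegral_eq_lintegral_meas_ofReal_lt
    (antitone_decreasingRearrangement μ u).measurable.aemeasurable]
  refine lintegral_mono fun a => ?_
  simp only
  set m := μ {x | ENNReal.ofReal a < ‖u x‖ₑ} with hm
  rw [Measure.restrict_apply (measurableSet_lt measurable_const
    (antitone_decreasingRearrangement μ u).measurable)]
  rcases eq_or_ne m ⊤ with h | h
  · simp [h]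
  · calc _ ≤ volume (Ioo 0 m.toReal) := by
          refine measure_mono fun s hs => ⟨hs.2, ?_⟩
          exact (ENNReal.ofReal_lt_iff_lt_toReal (le_of_lt hs.2) h).1
            (ofReal_lt_measure_of_lt_decreasingRearrangement hs.1)
      _ = m := by rw [Real.volume_Ioo, sub_zero, ENNReal.ofReal_toReal h]

theorem ofReal_mul_maximalRearrangement {f : α → ℝ} {t : ℝ} (ht : 0 < t) :
    ENNReal.ofReal t * maximalRearrangement μ f t
      = ∫⁻ s in Ioc 0 t, decreasingRearrangement μ f s := by
  rw [maximalRearrangement, ← mul_assoc, ENNReal.mul_inv_cancel (by simpa using ht) (by simp),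
    one_mul]

/-- `t f**(t)` is a lower bound for the `K`-functional of the couple `(L¹, L^∞)`. -/
theorem ofReal_mul_maximalRearrangement_le [SFinite μ] {f u v : α → ℝ} {t : ℝ} (ht : 0 < t)
    (hu : AEMeasurable u μ) (h : ∀ᵐ x ∂μ, ‖f x‖ₑ ≤ ‖u x‖ₑ + ‖v x‖ₑ) :
    ENNReal.ofReal t * maximalRearrangement μ f t
      ≤ eLpNorm u 1 μ + ENNReal.ofReal t * eLpNorm v ⊤ μ := by
  rw [ofReal_mul_maximalRearrangement ht, eLpNorm_one_eq_lintegral_enorm]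
  set b := eLpNorm v ⊤ μ with hb
  have hv : ∀ᵐ x ∂μ, ‖v x‖ₑ ≤ b := by
    rw [hb, eLpNorm_exponent_top]; exact ae_le_eLpNormEssSup
  have key (s : ℝ) : decreasingRearrangement μ f s ≤ decreasingRearrangement μ u s + b := by
    rw [decreasingRearrangement, decreasingRearrangement, ENNReal.sInf_add]
    refine le_iInf₂ fun a ha => sInf_le ?_
    refine le_trans (measure_mono_ae ?_) ha
    filter_upwards [h, hv] with x hx hvx (hlt : a + b < ‖f x‖ₑ)
    by_contra hle
    exact absurd hlt (not_lt.2 (hx.trans (add_le_add (not_lt.1 hle) hvx)))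
  calc ∫⁻ s in Ioc 0 t, decreasingRearrangement μ f s
      ≤ ∫⁻ s in Ioc 0 t, (decreasingRearrangement μ u s + b) := lintegral_mono key
    _ = (∫⁻ s in Ioc 0 t, decreasingRearrangement μ u s) + ENNReal.ofReal t * b := by
        rw [lintegral_add_right _ measurable_const, setLIntegral_const, Real.volume_Ioc, sub_zero,
          mul_comm]
    _ ≤ _ := by
        gcongr
        exact (lintegral_mono_set Ioc_subset_Ioi_self).trans
          (lintegral_decreasingRearrangement_le hu)

theorem decreasingRearrangement_le_maximalRearrangement {f : α → ℝ} {t : ℝ} (ht : 0 < t) :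
    decreasingRearrangement μ f t ≤ maximalRearrangement μ f t := by
  rw [← ENNReal.mul_le_mul_iff_right (a := ENNReal.ofReal t) (by simpa using ht) (by simp),
    ofReal_mul_maximalRearrangement ht]
  calc ENNReal.ofReal t * decreasingRearrangement μ f t
      = ∫⁻ _ in Ioc 0 t, decreasingRearrangement μ f t := by
        rw [setLIntegral_const, Real.volume_Ioc, sub_zero, mul_comm]
    _ ≤ _ := setLIntegral_mono (antitone_decreasingRearrangement μ f).measurable
        fun s hs => antitone_decreasingRearrangement μ f hs.2

theorem measure_lt_enorm_le_of_maximalRearrangement_lt {f : α → ℝ} {t : ℝ} {l : ℝ≥0∞} (ht : 0 < t)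
    (h : maximalRearrangement μ f t < l) : μ {x | l < ‖f x‖ₑ} ≤ ENNReal.ofReal t := by
  obtain ⟨b, hb, hbl⟩ := sInf_lt_iff.1
    ((decreasingRearrangement_le_maximalRearrangement ht).trans_lt h)
  exact (measure_mono fun x hx => lt_trans hbl hx).trans hb

/-- If `f**(t) < l`, then the part of `|f|` above the height `l` has integral at most `t l`. -/
theorem lintegral_enorm_sub_le_of_maximalRearrangement_lt [SFinite μ] {f : α → ℝ} {t l : ℝ}
    (ht : 0 < t) (hl : 0 < l) (hf : AEMeasurable f μ)
    (h : maximalRearrangement μ f t < ENNReal.ofReal l) :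
    ∫⁻ x, (‖f x‖ₑ - ENNReal.ofReal l) ∂μ ≤ ENNReal.ofReal t * ENNReal.ofReal l := by
  refine le_trans ?_ (mul_le_mul_right h.le (ENNReal.ofReal t))
  have hm : AEMeasurable (fun x => ‖f x‖ₑ - ENNReal.ofReal l) μ := hf.enorm.sub aemeasurable_const
  rw [ofReal_mul_maximalRearrangement ht, lintegral_eq_lintegral_meas_ofReal_lt hm,
    lintegral_eq_lintegral_meas_ofReal_lt
    (antitone_decreasingRearrangement μ f).measurable.aemeasurable]
  refine setLIntegral_mono' measurableSet_Ioi fun a (ha : 0 < a) => ?_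
  have hset : {x | ENNReal.ofReal a < ‖f x‖ₑ - ENNReal.ofReal l}
      = {x | ENNReal.ofReal (a + l) < ‖f x‖ₑ} := by
    ext x
    rw [mem_ofPred_eq, mem_ofPred_eq, lt_tsub_iff_right, ENNReal.ofReal_add ha.le hl.le]
  rw [hset]
  set m := μ {x | ENNReal.ofReal (a + l) < ‖f x‖ₑ} with hm
  have hmt : m ≤ ENNReal.ofReal t :=
    (measure_mono fun x hx => lt_of_le_of_lt (ENNReal.ofReal_le_ofReal (by linarith)) hx).trans
      (measure_lt_enorm_le_of_maximalRearrangement_lt ht h)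
  have hm' : m ≠ ⊤ := (hmt.trans_lt ENNReal.ofReal_lt_top).ne
  rw [Measure.restrict_apply (measurableSet_lt measurable_const
    (antitone_decreasingRearrangement μ f).measurable)]
  calc m = volume (Ioo 0 m.toReal) := by
        rw [Real.volume_Ioo, sub_zero, ENNReal.ofReal_toReal hm']
    _ ≤ _ := by
        refine measure_mono fun s hs => ⟨?_, hs.1, ?_⟩
        · refine lt_of_lt_of_le ((ENNReal.ofReal_lt_ofReal_iff (by linarith)).2 ?_)
            (le_decreasingRearrangement_of_ofReal_lt_measure (a := ENNReal.ofReal (a + l)) ?_)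
          · linarith
          · exact (ENNReal.ofReal_lt_iff_lt_toReal hs.1.le hm').2 hs.2
        · exact hs.2.le.trans (ENNReal.toReal_le_of_le_ofReal ht.le hmt)

/-- If `f**(t) < l`, then `∫_V |f| ≤ (1 + c) t l` for every set `V` of measure at most `c t`. -/
theorem setLIntegral_enorm_le_of_maximalRearrangement_lt [SFinite μ] {f : α → ℝ} {t l : ℝ}
    (ht : 0 < t) (hl : 0 < l) (hf : AEMeasurable f μ)
    (h : maximalRearrangement μ f t < ENNReal.ofReal l) {V : Set α} {c : ℝ≥0∞}
    (hV : μ V ≤ c * ENNReal.ofReal t) :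
    ∫⁻ x in V, ‖f x‖ₑ ∂μ ≤ (1 + c) * (ENNReal.ofReal t * ENNReal.ofReal l) := by
  calc ∫⁻ x in V, ‖f x‖ₑ ∂μ
      ≤ ∫⁻ x in V, ((‖f x‖ₑ - ENNReal.ofReal l) + ENNReal.ofReal l) ∂μ :=
        lintegral_mono fun x => le_tsub_add
    _ = (∫⁻ x in V, (‖f x‖ₑ - ENNReal.ofReal l) ∂μ) + ENNReal.ofReal l * μ V := by
        rw [lintegral_add_right _ measurable_const, setLIntegral_const]
    _ ≤ ENNReal.ofReal t * ENNReal.ofReal l + ENNReal.ofReal l * (c * ENNReal.ofReal t) := by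
        gcongr
        exact (setLIntegral_le_lintegral _ _).trans
          (lintegral_enorm_sub_le_of_maximalRearrangement_lt ht hl hf h)
    _ = _ := by ring

end Rearrangement

/-! ### The weak type inequality for the maximal function -/

section Maximal

variable {E : Type*} [NormedAddCommGroup E] [NormedSpace ℝ E] [FiniteDimensional ℝ E]
  [MeasurableSpace E] [BorelSpace E]

open Metric Module

/-- The set where the maximal function of `F` over centred closed balls exceeds `l`. -/
def maximalSet (μ : Measure E) (F : E → ℝ≥0∞) (l : ℝ≥0∞) : Set E :=
  {x | ∃ r : ℝ, 0 < r ∧ l * μ (closedBall x r) < ∫⁻ w in closedBall x r, F w ∂μ}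

/-- The weak type `(1, 1)` inequality, by the Vitali covering lemma. -/
theorem mul_measure_maximalSet_le [Nontrivial E] (μ : Measure E) [μ.IsAddHaarMeasure]
    {F : E → ℝ≥0∞} (hF : ∫⁻ x, F x ∂μ ≠ ⊤) {l : ℝ≥0∞} (hl : l ≠ 0) (hl' : l ≠ ⊤) :
    l * μ (maximalSet μ F l) ≤ 4 ^ finrank ℝ E * ∫⁻ x, F x ∂μ := by
  classical
  choose! r hr0 hr using fun x (hx : x ∈ maximalSet μ F l) => hx
  set β := μ (ball (0 : E) 1) with hβ
  have hβ0 : β ≠ 0 := (measure_ball_pos μ 0 one_pos).ne'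
  have hβt : β ≠ ⊤ := measure_ball_lt_top.ne
  set I := ∫⁻ x, F x ∂μ with hI
  -- The radii are bounded because `l * β * r ^ n` is at most the total integral.
  have hbdd : ∀ x ∈ maximalSet μ F l, r x ≤ max 1 (I / (l * β)).toReal := by
    intro x hx
    by_contra! hlt
    have h1 : 1 ≤ r x := ((le_max_left _ _).trans_lt hlt).le
    have h2 : (I / (l * β)).toReal < r x := (le_max_right _ _).trans_lt hlt
    have h3 : l * μ (closedBall x (r x)) < I := (hr x hx).trans_le (setLIntegral_le_lintegral _ _)
    rw [μ.addHaar_closedBall x (hr0 x hx).le] at h3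
    have hne : I / (l * β) ≠ ⊤ := ENNReal.div_ne_top hF (mul_ne_zero hl hβ0)
    have h4 : I / (l * β) < ENNReal.ofReal (r x ^ finrank ℝ E) := by
      rw [ENNReal.lt_ofReal_iff_toReal_lt hne]
      exact h2.trans_le (le_self_pow₀ h1 finrank_pos.ne')
    rw [ENNReal.div_lt_iff (Or.inl (mul_ne_zero hl hβ0))
      (Or.inl (ENNReal.mul_ne_top hl' hβt))] at h4
    rw [mul_left_comm] at h3
    exact absurd (h4.trans h3) (lt_irrefl _)
  obtain ⟨u, hu, hdisj, hcov⟩ := Vitali.exists_disjoint_subfamily_covering_enlargement_closedBall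
    (maximalSet μ F l) (fun x => x) r _ hbdd 4 (by norm_num)
  have hcount : u.Countable := hdisj.countable_of_nonempty_interior fun x hx => by
    refine ⟨x, interior_mono ball_subset_closedBall ?_⟩
    rw [isOpen_ball.interior_eq]
    exact mem_ball_self (hr0 x (hu hx))
  have : Countable u := hcount.to_subtype
  calc l * μ (maximalSet μ F l)
      ≤ l * μ (⋃ x ∈ u, closedBall x (4 * r x)) := by
        gcongr
        intro x hx
        obtain ⟨y, hy, hxy⟩ := hcov x hx
        exact mem_biUnion hy (hxy (mem_closedBall_self (hr0 x hx).le))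
    _ ≤ l * ∑' x : u, μ (closedBall (x : E) (4 * r x)) := by
        gcongr; exact measure_biUnion_le μ hcount _
    _ = l * ∑' x : u, 4 ^ finrank ℝ E * μ (closedBall (x : E) (r x)) := by
        congr 2; ext x
        have hx := (hr0 x (hu x.2)).le
        rw [μ.addHaar_closedBall _ (by positivity), μ.addHaar_closedBall _ hx, mul_pow,
          ENNReal.ofReal_mul (by positivity), mul_assoc, ENNReal.ofReal_pow (by positivity)]
        simp
    _ = 4 ^ finrank ℝ E * ∑' x : u, l * μ (closedBall (x : E) (r x)) := by
        rw [ENNReal.tsum_mul_left, ENNReal.tsum_mul_left]; ring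
    _ ≤ 4 ^ finrank ℝ E * ∑' x : u, ∫⁻ w in closedBall (x : E) (r x), F w ∂μ := by
        gcongr with x; exact (hr x (hu x.2)).le
    _ = 4 ^ finrank ℝ E * ∫⁻ w in ⋃ x : u, closedBall (x : E) (r x), F w ∂μ := by
        rw [lintegral_iUnion (fun x => measurableSet_closedBall)]
        exact hdisj.subtype _ _
    _ ≤ _ := by gcongr; exact setLIntegral_le_lintegral _ _

end Maximal

/-! ### Weak gradients -/

variable {d : ℕ}

/-- The ambient space `ℝⁿ`, `n = d + 1`. -/
abbrev Space (d : ℕ) := EuclideanSpace ℝ (Fin (d + 1))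

theorem isOpen_doubleCone : IsOpen (doubleCone d) :=
  isOpen_lt (by fun_prop) (by fun_prop)

theorem measurableSet_doubleCone : MeasurableSet (doubleCone d) :=
  isOpen_doubleCone.measurableSet

theorem doubleCone_subset_closedDoubleCone : doubleCone d ⊆ closedDoubleCone d := subset_closure

theorem ae_mem_doubleCone : ∀ᵐ x ∂coneMeasure d, x ∈ doubleCone d :=
  ae_restrict_mem measurableSet_doubleCone

instance : SFinite (coneMeasure d) := by unfold coneMeasure; infer_instance

theorem integrable_mul_of_tsupport_subset {f : Space d → ℝ}
    (hf : LocallyIntegrableOn f (doubleCone d) volume) {ψ : Space d → ℝ} (hψ : Continuous ψ)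
    (hc : HasCompactSupport ψ) (hs : tsupport ψ ⊆ doubleCone d) :
    Integrable (fun x => f x * ψ x) (volume.restrict (doubleCone d)) := by
  have h1 : IntegrableOn f (tsupport ψ) volume := hf.integrableOn_compact_subset hs hc
  have h2 : IntegrableOn (fun x => f x * ψ x) (tsupport ψ) volume :=
    h1.mul_continuousOn hψ.continuousOn hc
  refine Integrable.mono_measure ?_ Measure.restrict_le_self
  refine (integrableOn_iff_integrable_of_support_subset ?_).1 h2
  exact (Function.support_mul_subset_right _ _).trans (subset_tsupport ψ)

theorem locallyIntegrableOn_apply {G : Space d → Space d}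
    (hG : LocallyIntegrableOn G (doubleCone d) volume) (i : Fin (d + 1)) :
    LocallyIntegrableOn (fun x => G x i) (doubleCone d) volume := fun x hx => by
  obtain ⟨s, hs, h⟩ := hG x hx
  exact ⟨s, hs, (EuclideanSpace.proj (𝕜 := ℝ) i).integrable_comp h⟩

theorem locallyIntegrableOn_congr {F : Type*} [NormedAddCommGroup F] {f g : Space d → F}
    (hf : LocallyIntegrableOn f (doubleCone d) volume) (h : f =ᵐ[coneMeasure d] g) :
    LocallyIntegrableOn g (doubleCone d) volume := fun x hx => by
  obtain ⟨s, hs, hi⟩ := hf x hx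
  refine ⟨s ∩ doubleCone d, inter_mem hs self_mem_nhdsWithin, ?_⟩
  refine (hi.mono_set inter_subset_left).congr ?_
  exact ae_restrict_of_ae_restrict_of_subset inter_subset_right h

theorem continuous_fderiv_apply {φ : Space d → ℝ} (hφ : ContDiff ℝ ∞ φ) (v : Space d) :
    Continuous fun x => fderiv ℝ φ x v :=
  (hφ.continuous_fderiv (by simp)).clm_apply continuous_const

theorem HasWeakGradient.congr {f g : Space d → ℝ} {G H : Space d → Space d}
    (h : HasWeakGradient f G) (hfg : f =ᵐ[coneMeasure d] g) (hGH : G =ᵐ[coneMeasure d] H) :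
    HasWeakGradient g H := by
  refine ⟨locallyIntegrableOn_congr h.1 hfg, locallyIntegrableOn_congr h.2 hGH, ?_⟩
  intro φ h1 h2 h3 i
  have e := h.3 φ h1 h2 h3 i
  have e1 : ∫ x in doubleCone d, f x * fderiv ℝ φ x (EuclideanSpace.single i 1)
      = ∫ x in doubleCone d, g x * fderiv ℝ φ x (EuclideanSpace.single i 1) :=
    integral_congr_ae (by filter_upwards [hfg] with x hx; rw [hx])
  have e2 : ∫ x in doubleCone d, G x i * φ x = ∫ x in doubleCone d, H x i * φ x :=
    integral_congr_ae (by filter_upwards [hGH] with x hx; rw [hx])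
  rw [← e1, ← e2, e]

theorem HasWeakGradient.add {f g : Space d → ℝ} {G H : Space d → Space d}
    (h : HasWeakGradient f G) (h' : HasWeakGradient g H) :
    HasWeakGradient (fun x => f x + g x) (fun x => G x + H x) := by
  refine ⟨h.1.add h'.1, h.2.add h'.2, fun φ h1 h2 h3 i => ?_⟩
  have hc := continuous_fderiv_apply h1 (EuclideanSpace.single i 1)
  have hs := h2.fderiv_apply ℝ (EuclideanSpace.single i 1)
  have ht := (tsupport_fderiv_apply_subset ℝ (f := φ) (EuclideanSpace.single i 1)).trans h3
  have e1 := h.3 φ h1 h2 h3 i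
  have e2 := h'.3 φ h1 h2 h3 i
  simp only [add_mul, PiLp.add_apply]
  rw [integral_add (integrable_mul_of_tsupport_subset h.1 hc hs ht)
    (integrable_mul_of_tsupport_subset h'.1 hc hs ht),
    integral_add (integrable_mul_of_tsupport_subset (locallyIntegrableOn_apply h.2 i)
      h1.continuous h2 h3) (integrable_mul_of_tsupport_subset (locallyIntegrableOn_apply h'.2 i)
      h1.continuous h2 h3), e1, e2]
  ring

theorem HasWeakGradient.neg {f : Space d → ℝ} {G : Space d → Space d} (h : HasWeakGradient f G) :
    HasWeakGradient (fun x => - f x) (fun x => - G x) := by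
  refine ⟨h.1.neg, h.2.neg, fun φ h1 h2 h3 i => ?_⟩
  simp only [neg_mul, PiLp.neg_apply, integral_neg, h.3 φ h1 h2 h3 i]

theorem HasWeakGradient.sub {f g : Space d → ℝ} {G H : Space d → Space d}
    (h : HasWeakGradient f G) (h' : HasWeakGradient g H) :
    HasWeakGradient (fun x => f x - g x) (fun x => G x - H x) := by
  simpa only [sub_eq_add_neg] using h.add h'.neg

/-- The fundamental lemma of the calculus of variations on the cone, for vector fields. -/
theorem ae_eq_zero_of_forall_integral_apply_mul_eq_zero {G : Space d → Space d}
    (hG : LocallyIntegrableOn G (doubleCone d) volume)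
    (h : ∀ φ : Space d → ℝ, ContDiff ℝ ∞ φ → HasCompactSupport φ → tsupport φ ⊆ doubleCone d →
      ∀ i, ∫ x in doubleCone d, G x i * φ x = 0) :
    ∀ᵐ x ∂coneMeasure d, G x = 0 := by
  have key (i : Fin (d + 1)) : ∀ᵐ x ∂coneMeasure d, G x i = 0 := by
    have := isOpen_doubleCone.ae_eq_zero_of_integral_contDiff_smul_eq_zero
      (locallyIntegrableOn_apply hG i) (μ := volume) fun φ h1 h2 h3 => by
        rw [← h φ h1 h2 h3 i, ← integral_indicator measurableSet_doubleCone]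
        congr 1; ext x
        by_cases hx : x ∈ doubleCone d
        · rw [indicator_of_mem hx, smul_eq_mul, mul_comm]
        · rw [indicator_of_notMem hx, image_eq_zero_of_notMem_tsupport (fun h' => hx (h3 h')),
            zero_smul]
    exact (ae_restrict_iff' measurableSet_doubleCone).2 this
  filter_upwards [ae_all_iff.2 key] with x hx
  ext i
  exact hx i

theorem HasWeakGradient.unique {f : Space d → ℝ} {G H : Space d → Space d}
    (h : HasWeakGradient f G) (h' : HasWeakGradient f H) : G =ᵐ[coneMeasure d] H := by
  have := ae_eq_zero_of_forall_integral_apply_mul_eq_zero (G := fun x => G x - H x)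
    (h.2.sub h'.2) fun φ h1 h2 h3 i => by
      have e := (h.sub h').3 φ h1 h2 h3 i
      simp only [sub_self, zero_mul, integral_zero] at e
      linarith
  filter_upwards [this] with x hx
  exact sub_eq_zero.1 hx

theorem HasWeakGradient.weakGradient_spec {f : Space d → ℝ} {G : Space d → Space d}
    (h : HasWeakGradient f G) : HasWeakGradient f (weakGradient f) := by
  have hex : ∃ G, HasWeakGradient f G := ⟨G, h⟩
  rw [weakGradient, dif_pos hex]
  exact hex.choose_spec

theorem HasWeakGradient.weakGradient_ae_eq {f : Space d → ℝ} {G : Space d → Space d}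
    (h : HasWeakGradient f G) : weakGradient f =ᵐ[coneMeasure d] G :=
  h.weakGradient_spec.unique h

theorem HasWeakGradient.normW1_eq {p : ℝ≥0∞} {f : Space d → ℝ} {G : Space d → Space d}
    (h : HasWeakGradient f G) :
    normW1 p f = eLpNorm f p (coneMeasure d) + eLpNorm G p (coneMeasure d) := by
  rw [normW1, eLpNorm_congr_ae h.weakGradient_ae_eq]

theorem HasWeakGradient.normTildeH1_eq {p : ℝ≥0∞} {f : Space d → ℝ} {G : Space d → Space d}
    (h : HasWeakGradient f G) :
    normTildeH1 p f = eLpNorm f p (coneMeasure d) + eLpNorm G p (coneMeasure d)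
      + eLpNorm (fun x => f x / ‖x‖) p (coneMeasure d) := by
  rw [normTildeH1, h.normW1_eq]

/-! ### Lipschitz functions -/

theorem norm_gradient_le {K : ℝ≥0} {g : Space d → ℝ} (hg : LipschitzWith K g) (x : Space d) :
    ‖gradient g x‖ ≤ K := by
  rw [gradient, LinearIsometryEquiv.norm_map]
  exact norm_fderiv_le_of_lipschitz ℝ hg

theorem measurable_gradient (g : Space d → ℝ) : Measurable (gradient g) :=
  (InnerProductSpace.toDual ℝ (Space d)).symm.continuous.measurable.comp (measurable_fderiv ℝ g)

theorem gradient_apply (g : Space d → ℝ) (x : Space d) (i : Fin (d + 1)) :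
    gradient g x i = fderiv ℝ g x (EuclideanSpace.single i 1) := by
  have happ (v : Space d) : inner ℝ (gradient g x) v = fderiv ℝ g x v :=
    InnerProductSpace.toDual_symm_apply
  rw [← happ, EuclideanSpace.inner_single_right]; simp

/-- The gradient of a Lipschitz function, which exists almost everywhere by Rademacher's theorem,
is its weak gradient. -/
theorem hasWeakGradient_gradient {K : ℝ≥0} {g : Space d → ℝ} (hg : LipschitzWith K g) :
    HasWeakGradient g (gradient g) := by
  refine ⟨hg.continuous.locallyIntegrable.locallyIntegrableOn _, ?_, fun φ h1 h2 h3 i => ?_⟩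
  · refine LocallyIntegrable.locallyIntegrableOn ?_ _
    exact (memLp_top_of_bound (measurable_gradient g).aestronglyMeasurable K
      (ae_of_all _ (norm_gradient_le hg))).locallyIntegrable le_top
  · obtain ⟨D, hD⟩ := ContDiff.lipschitzWith_of_hasCompactSupport h2 h1 (by simp)
    have key := hg.integral_lineDeriv_mul_eq hD h2 (EuclideanSpace.single i (1 : ℝ)) (μ := volume)
    have hz (x : Space d) (hx : x ∉ doubleCone d) : φ x = 0 :=
      image_eq_zero_of_notMem_tsupport fun h' => hx (h3 h')
    have hz' (x : Space d) (hx : x ∉ doubleCone d) :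
        fderiv ℝ φ x (EuclideanSpace.single i 1) = 0 :=
      image_eq_zero_of_notMem_tsupport (f := fun x => fderiv ℝ φ x (EuclideanSpace.single i 1))
        fun h' => hx (h3 (tsupport_fderiv_apply_subset ℝ _ h'))
    rw [setIntegral_eq_integral_of_forall_compl_eq_zero fun x hx => by rw [hz' x hx, mul_zero],
      setIntegral_eq_integral_of_forall_compl_eq_zero fun x hx => by rw [hz x hx, mul_zero]]
    have e1 : ∫ x, lineDeriv ℝ g x (EuclideanSpace.single i 1) * φ x
        = ∫ x, gradient g x i * φ x := by
      refine integral_congr_ae ?_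
      filter_upwards [hg.ae_differentiableAt (μ := volume)] with x hx
      rw [hx.lineDeriv_eq_fderiv, gradient_apply]
    rw [← e1, key, ← integral_neg]
    refine integral_congr_ae (ae_of_all _ fun x => ?_)
    simp only [((h1.differentiable (by simp)) x).lineDeriv_eq_fderiv, map_neg]
    ring

theorem LipschitzOnCone.exists_extension {f : Space d → ℝ} (hf : LipschitzOnCone f) :
    ∃ (K : ℝ≥0) (g : Space d → ℝ), LipschitzWith K g ∧ EqOn f g (closedDoubleCone d) := by
  obtain ⟨K, hK⟩ := hf
  obtain ⟨g, hg, h⟩ := (lipschitzOnWith_iff_restrict.2 hK).extend_real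
  exact ⟨K, g, hg, h⟩

theorem LipschitzWith.lipschitzOnCone {K : ℝ≥0} {f : Space d → ℝ} (hf : LipschitzWith K f) :
    LipschitzOnCone f := ⟨K, lipschitzOnWith_iff_restrict.1 hf.lipschitzOnWith⟩

theorem ae_eq_of_eqOn_closedDoubleCone {f g : Space d → ℝ} (h : EqOn f g (closedDoubleCone d)) :
    f =ᵐ[coneMeasure d] g := by
  filter_upwards [ae_mem_doubleCone] with x hx
  exact h (doubleCone_subset_closedDoubleCone hx)

theorem LipschitzOnCone.exists_hasWeakGradient {f : Space d → ℝ} (hf : LipschitzOnCone f) :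
    ∃ G, HasWeakGradient f G := by
  obtain ⟨K, g, hg, h⟩ := hf.exists_extension
  exact ⟨_, (hasWeakGradient_gradient hg).congr (ae_eq_of_eqOn_closedDoubleCone h).symm .rfl⟩

theorem MemTildeH1.exists_hasWeakGradient {p : ℝ≥0∞} {f : Space d → ℝ} (hf : MemTildeH1 p f) :
    ∃ G, HasWeakGradient f G := by
  have h := hf.1
  unfold MemH1 at h
  split_ifs at h with hp
  · obtain ⟨g, hfg, hg, -⟩ := h
    obtain ⟨G, hG⟩ := hg.exists_hasWeakGradient
    exact ⟨G, hG.congr hfg.symm .rfl⟩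
  · obtain ⟨G, hG, -⟩ := h.1.2
    exact ⟨G, hG⟩

/-- The lower bound for the `K`-functional. -/
theorem ofReal_mul_sum_maximalRearrangement_le_kFunctionalTildeH1 (f : Space d → ℝ) {t : ℝ}
    (ht : 0 < t) :
    ENNReal.ofReal t * (maximalRearrangement (coneMeasure d) f t
        + maximalRearrangement (coneMeasure d) (fun x => |f x| / ‖x‖) t
        + maximalRearrangement (coneMeasure d) (fun x => ‖weakGradient f x‖) t)
      ≤ kFunctionalTildeH1 f t := by
  refine le_iInf fun f₀ => le_iInf fun f₁ => le_iInf fun h₀ => le_iInf fun h₁ => le_iInf fun h => ?_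
  obtain ⟨G₀, hG₀⟩ := h₀.exists_hasWeakGradient
  obtain ⟨G₁, hG₁⟩ := h₁.exists_hasWeakGradient
  have hG : weakGradient f =ᵐ[coneMeasure d] fun x => G₀ x + G₁ x :=
    ((hG₀.add hG₁).congr h.symm .rfl).weakGradient_ae_eq
  have hW : MemW1 1 f₀ := by
    have := h₀.1
    rw [MemH1, if_neg (by simp)] at this
    exact this.1
  have hG₀m : AEStronglyMeasurable G₀ (coneMeasure d) := by
    obtain ⟨G, hG', hm⟩ := hW.2
    exact hm.1.congr (hG'.unique hG₀)
  rw [hG₀.normTildeH1_eq, hG₁.normTildeH1_eq]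
  have b1 : ENNReal.ofReal t * maximalRearrangement (coneMeasure d) f t ≤ _ :=
    ofReal_mul_maximalRearrangement_le (u := f₀) (v := f₁) ht hW.1.1.aemeasurable (by
      filter_upwards [h] with x hx
      rw [hx]; exact enorm_add_le _ _)
  have b2 : ENNReal.ofReal t * maximalRearrangement (coneMeasure d) (fun x => |f x| / ‖x‖) t ≤ _ :=
    ofReal_mul_maximalRearrangement_le (u := fun x => f₀ x / ‖x‖) (v := fun x => f₁ x / ‖x‖) ht
      h₀.2.1.aemeasurable (by
      filter_upwards [h] with x hx
      have : ‖|f x| / ‖x‖‖ₑ = ‖f₀ x / ‖x‖ + f₁ x / ‖x‖‖ₑ := by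
        rw [← add_div, ← hx, enorm_eq_iff_norm_eq]; simp
      rw [this]; exact enorm_add_le _ _)
  have b3 : ENNReal.ofReal t * maximalRearrangement (coneMeasure d) (fun x => ‖weakGradient f x‖) t
      ≤ _ := ofReal_mul_maximalRearrangement_le (u := fun x => ‖G₀ x‖) (v := fun x => ‖G₁ x‖) ht
      hG₀m.norm.aemeasurable (by
      filter_upwards [hG] with x hx
      rw [hx]
      simp only [enorm_norm]
      exact enorm_add_le _ _)
  rw [eLpNorm_norm, eLpNorm_norm] at b3
  rw [mul_add, mul_add]
  refine (add_le_add (add_le_add b1 b2) b3).trans (le_of_eq ?_)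
  ring

/-! ### Geometry of the two halves of the cone -/

/-- The projection `(x₁, …, xₙ) ↦ (x₁, …, xₙ₋₁)`. -/
def headPart (d : ℕ) : Space d →ₗ[ℝ] EuclideanSpace ℝ (Fin d) where
  toFun x := WithLp.toLp 2 fun i => x i.castSucc
  map_add' _ _ := rfl
  map_smul' _ _ := rfl

theorem norm_headPart_sq (x : Space d) : ‖headPart d x‖ ^ 2 = ∑ i : Fin d, x i.castSucc ^ 2 := by
  rw [EuclideanSpace.real_norm_sq_eq]; rfl

theorem norm_sq_eq_headPart_add (x : Space d) :
    ‖x‖ ^ 2 = ‖headPart d x‖ ^ 2 + x (Fin.last d) ^ 2 := by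
  rw [EuclideanSpace.real_norm_sq_eq, Fin.sum_univ_castSucc, norm_headPart_sq]

theorem norm_headPart_le (x : Space d) : ‖headPart d x‖ ≤ ‖x‖ := by
  refine le_of_sq_le_sq ?_ (norm_nonneg _)
  nlinarith [norm_sq_eq_headPart_add x, sq_nonneg (x (Fin.last d))]

theorem abs_last_le (x : Space d) : |x (Fin.last d)| ≤ ‖x‖ := by
  refine abs_le_of_sq_le_sq ?_ (norm_nonneg _)
  nlinarith [norm_sq_eq_headPart_add x, sq_nonneg ‖headPart d x‖]

/-- The half of the double cone on which the last coordinate has the sign `σ = ± 1`. -/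
def halfCone (d : ℕ) (σ : ℝ) : Set (Space d) := {x | ‖headPart d x‖ < σ * x (Fin.last d)}

theorem mem_halfCone {σ : ℝ} {x : Space d} :
    x ∈ halfCone d σ ↔ ‖headPart d x‖ < σ * x (Fin.last d) := Iff.rfl

theorem halfCone_subset_doubleCone {σ : ℝ} (hσ : σ ^ 2 = 1) : halfCone d σ ⊆ doubleCone d := by
  intro x hx
  rw [mem_halfCone] at hx
  change ∑ i : Fin d, x i.castSucc ^ 2 < x (Fin.last d) ^ 2
  rw [← norm_headPart_sq]
  have := mul_self_lt_mul_self (norm_nonneg _) hx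
  calc _ = ‖headPart d x‖ * ‖headPart d x‖ := sq _
    _ < _ := this
    _ = σ ^ 2 * x (Fin.last d) ^ 2 := by ring
    _ = _ := by rw [hσ, one_mul]

theorem mem_halfCone_or {x : Space d} (hx : x ∈ doubleCone d) :
    x ∈ halfCone d 1 ∨ x ∈ halfCone d (-1) := by
  change ∑ i : Fin d, x i.castSucc ^ 2 < x (Fin.last d) ^ 2 at hx
  rw [← norm_headPart_sq] at hx
  have h := sq_lt_sq.1 hx
  rw [abs_norm] at h
  rcases le_total 0 (x (Fin.last d)) with h0 | h0
  · left; rw [mem_halfCone, one_mul]; rwa [abs_of_nonneg h0] at h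
  · right; rw [mem_halfCone, neg_one_mul]; rwa [abs_of_nonpos h0] at h

theorem convex_halfCone (σ : ℝ) : Convex ℝ (halfCone d σ) := by
  intro x hx y hy a b ha hb hab
  rw [mem_halfCone] at hx hy ⊢
  have h1 : ‖headPart d (a • x + b • y)‖ ≤ a * ‖headPart d x‖ + b * ‖headPart d y‖ := by
    rw [map_add, map_smul, map_smul]
    refine (norm_add_le _ _).trans (le_of_eq ?_)
    rw [norm_smul, norm_smul, Real.norm_of_nonneg ha, Real.norm_of_nonneg hb]
  have h2 : σ * (a • x + b • y) (Fin.last d)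
      = a * (σ * x (Fin.last d)) + b * (σ * y (Fin.last d)) := by
    simp only [PiLp.add_apply, PiLp.smul_apply, smul_eq_mul]; ring
  rw [h2]
  refine h1.trans_lt ?_
  rcases ha.eq_or_lt with rfl | ha
  · have : b = 1 := by linarith
    simpa [this] using hy
  · have := mul_le_mul_of_nonneg_left hy.le hb
    have := mul_lt_mul_of_pos_left hx ha
    linarith

theorem closedBall_subset_halfCone {σ : ℝ} (hσ : σ ^ 2 = 1) {x : Space d} (hx : x ∈ halfCone d σ)
    (h : ℝ) : Metric.closedBall (x + (h * σ) • EuclideanSpace.single (Fin.last d) 1) (h / 2)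
      ⊆ halfCone d σ := by
  intro z hz
  set v := z - (x + (h * σ) • EuclideanSpace.single (Fin.last d) 1) with hv
  have hvn : ‖v‖ ≤ h / 2 := by rwa [mem_closedBall_iff_norm] at hz
  have hz' : z = x + (h * σ) • EuclideanSpace.single (Fin.last d) 1 + v := by rw [hv]; abel
  have hp : headPart d (EuclideanSpace.single (Fin.last d) 1) = 0 := by
    ext i
    change (EuclideanSpace.single (Fin.last d) (1 : ℝ) : Space d) i.castSucc = 0
    rw [PiLp.single_apply, if_neg (Fin.castSucc_lt_last i).ne]
  rw [mem_halfCone] at hx ⊢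
  have h1 : ‖headPart d z‖ ≤ ‖headPart d x‖ + h / 2 := by
    rw [hz', map_add, map_add, map_smul, hp, smul_zero, add_zero]
    exact (norm_add_le _ _).trans (by gcongr; exact (norm_headPart_le v).trans hvn)
  have h2 : σ * z (Fin.last d) = σ * x (Fin.last d) + h + σ * v (Fin.last d) := by
    rw [hz']
    simp only [PiLp.add_apply, PiLp.smul_apply, smul_eq_mul, PiLp.single_apply, if_true]
    linear_combination h * hσ
  have h3 : |σ * v (Fin.last d)| ≤ h / 2 := by
    have : |σ| = 1 := by
      rcases eq_or_eq_neg_of_sq_eq_sq σ 1 (by rw [hσ, one_pow]) with rfl | rfl <;> simp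
    rw [abs_mul, this, one_mul]
    exact (abs_last_le v).trans hvn
  have := neg_abs_le (σ * v (Fin.last d))
  linarith

theorem norm_le_two_mul_of_mem_halfCone {σ : ℝ} (hσ : σ ^ 2 = 1) {x : Space d}
    (hx : x ∈ halfCone d σ) : ‖x‖ ≤ 2 * (σ * x (Fin.last d)) := by
  rw [mem_halfCone] at hx
  have h0 := (norm_nonneg _).trans hx.le
  refine le_of_sq_le_sq ?_ (by linarith)
  have := mul_self_le_mul_self (norm_nonneg _) hx.le
  have h1 := norm_sq_eq_headPart_add x
  have h2 : (σ * x (Fin.last d)) * (σ * x (Fin.last d)) = x (Fin.last d) ^ 2 := by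
    linear_combination (x (Fin.last d)) ^ 2 * hσ
  nlinarith

theorem norm_add_norm_le_of_mem_halfCone {x y : Space d} (hx : x ∈ halfCone d 1)
    (hy : y ∈ halfCone d (-1)) : ‖x‖ + ‖y‖ ≤ 2 * ‖x - y‖ := by
  have h1 := norm_le_two_mul_of_mem_halfCone (by norm_num) hx
  have h2 := norm_le_two_mul_of_mem_halfCone (by norm_num) hy
  have h3 := (le_abs_self _).trans (abs_last_le (x - y))
  rw [PiLp.sub_apply] at h3
  linarith

/-! ### Averages of weakly differentiable functions along rays -/

section Ray

variable {k : Space d → ℝ} {H : Set (Space d)} {x : Space d}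

theorem notMem_tsupport_of_norm_sub_gt {R : ℝ} (hR : tsupport k ⊆ Metric.closedBall x R) {s : ℝ}
    (hs : 0 < s) {w : Space d} (hw : R / s < ‖w - x‖) : x + s • (w - x) ∉ tsupport k := by
  intro h
  have := hR h
  rw [mem_closedBall_iff_norm, add_sub_cancel_left, norm_smul, Real.norm_of_nonneg hs.le] at this
  rw [div_lt_iff₀ hs] at hw
  linarith

theorem tsupport_comp_dilation_subset (hconv : Convex ℝ H) (hx : x ∈ H) (hks : tsupport k ⊆ H)
    {s : ℝ} (hs : 1 ≤ s) : tsupport (fun w => k (x + s • (w - x))) ⊆ H := by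
  intro w hw
  have hw' : x + s • (w - x) ∈ H :=
    hks (tsupport_comp_subset_preimage k (f := fun w => x + s • (w - x)) (by fun_prop) hw)
  have hs0 : 0 < s := by linarith
  have := hconv hx hw' (a := 1 - s⁻¹) (b := s⁻¹) (sub_nonneg.2 (inv_le_one_of_one_le₀ hs))
    (by positivity) (by ring)
  convert this using 1
  rw [smul_add, smul_smul, inv_mul_cancel₀ hs0.ne', one_smul, sub_smul, one_smul]
  abel

theorem hasCompactSupport_comp_dilation (hc : HasCompactSupport k) {s : ℝ} (hs : 1 ≤ s) :
    HasCompactSupport fun w => k (x + s • (w - x)) := by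
  obtain ⟨R, hR⟩ := hc.isBounded.subset_closedBall x
  refine HasCompactSupport.intro (isCompact_closedBall x (R / s)) fun w hw => ?_
  rw [mem_closedBall_iff_norm, not_le] at hw
  exact image_eq_zero_of_notMem_tsupport (notMem_tsupport_of_norm_sub_gt hR (by linarith) hw)

theorem hasDerivAt_integral_mul_comp_dilation {u : Space d → ℝ}
    (h : LocallyIntegrableOn u (doubleCone d) volume)
    (hu : LocallyIntegrable ((doubleCone d).indicator u) volume)
    (hk : ContDiff ℝ ∞ k) (hc : HasCompactSupport k) (hconv : Convex ℝ H)
    (hH : H ⊆ doubleCone d) (hx : x ∈ H) (hks : tsupport k ⊆ H) {s : ℝ} (hs : 1 ≤ s) :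
    Integrable (fun w => u w * fderiv ℝ k (x + s • (w - x)) (w - x))
        (volume.restrict (doubleCone d)) ∧
      HasDerivAt (fun s : ℝ => ∫ w in doubleCone d, u w * k (x + s • (w - x)))
        (∫ w in doubleCone d, u w * fderiv ℝ k (x + s • (w - x)) (w - x)) s := by
  obtain ⟨R, hR⟩ := hc.isBounded.subset_closedBall x
  obtain ⟨D, hD⟩ := ContDiff.lipschitzWith_of_hasCompactSupport hc hk (by simp)
  have hkd : Differentiable ℝ k := hk.differentiable (by simp)
  have hum : AEStronglyMeasurable u (volume.restrict (doubleCone d)) :=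
    h.aestronglyMeasurable
  have hcompact := hasCompactSupport_comp_dilation (x := x) hc hs
  have hsupp := (tsupport_comp_dilation_subset hconv hx hks hs).trans hH
  have hcd : ContDiff ℝ ∞ fun w => k (x + s • (w - x)) := hk.comp (by fun_prop)
  have hcf (s : ℝ) : Continuous fun w => fderiv ℝ k (x + s • (w - x)) (w - x) :=
    ((hk.continuous_fderiv (by simp)).comp (by fun_prop)).clm_apply (by fun_prop)
  exact hasDerivAt_integral_of_dominated_loc_of_deriv_le
    (μ := volume.restrict (doubleCone d)) (x₀ := s) (s := Metric.ball s (1 / 2))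
    (F := fun s w => u w * k (x + s • (w - x)))
    (F' := fun s w => u w * fderiv ℝ k (x + s • (w - x)) (w - x))
    (bound := (Metric.closedBall x (2 * R)).indicator fun w => ‖u w‖ * (D * (2 * R)))
    (Metric.ball_mem_nhds s (by norm_num))
    (Eventually.of_forall fun s => hum.mul (hk.continuous.comp
      (by fun_prop : Continuous fun w => x + s • (w - x))).aestronglyMeasurable)
    (integrable_mul_of_tsupport_subset h hcd.continuous hcompact hsupp)
    (hum.mul (hcf s).aestronglyMeasurable)
    (ae_of_all _ fun w r hr => by
      have hr : 1 / 2 < r := by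
        rw [Metric.mem_ball, Real.dist_eq, abs_lt] at hr; linarith
      by_cases hw : w ∈ Metric.closedBall x (2 * R)
      · rw [indicator_of_mem hw, norm_mul]
        rw [mem_closedBall_iff_norm] at hw
        gcongr
        refine (ContinuousLinearMap.le_opNorm _ _).trans ?_
        gcongr
        exact norm_fderiv_le_of_lipschitz ℝ hD
      · rw [indicator_of_notMem hw]
        rw [mem_closedBall_iff_norm, not_le] at hw
        have hlt : R / r < ‖w - x‖ := by
          rw [div_lt_iff₀ (by linarith)]
          nlinarith [norm_nonneg (w - x)]
        have h0 := notMem_tsupport_of_norm_sub_gt hR (by linarith) hlt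
        have : fderiv ℝ k (x + r • (w - x)) = 0 :=
          image_eq_zero_of_notMem_tsupport fun h' => h0 (tsupport_fderiv_subset ℝ h')
        rw [this]; simp)
    (by
      rw [integrable_indicator_iff measurableSet_closedBall, IntegrableOn,
        Measure.restrict_restrict measurableSet_closedBall]
      have := hu.integrableOn_isCompact (isCompact_closedBall x (2 * R))
      rw [integrableOn_indicator_iff measurableSet_doubleCone, inter_comm] at this
      exact this.norm.mul_const _)
    (ae_of_all _ fun w r hr => by
      have h1 : HasDerivAt (fun r : ℝ => x + r • (w - x)) (w - x) r := by
        simpa using ((hasDerivAt_id r).smul_const (w - x)).const_add x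
      exact ((hkd _).hasFDerivAt.comp_hasDerivAt r h1).const_mul (u w))

theorem fderiv_sub_apply_mul_comp_dilation (hk : Differentiable ℝ k) (s : ℝ) (i : Fin (d + 1))
    (w : Space d) :
    fderiv ℝ (fun w => (w - x) i * k (x + s • (w - x))) w (EuclideanSpace.single i 1)
      = k (x + s • (w - x))
        + s * ((w - x) i * fderiv ℝ k (x + s • (w - x)) (EuclideanSpace.single i 1)) := by
  have h1 : HasFDerivAt (fun w : Space d => (w - x) i)
      (EuclideanSpace.proj (𝕜 := ℝ) i : Space d →L[ℝ] ℝ) w :=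
    (EuclideanSpace.proj (𝕜 := ℝ) i).hasFDerivAt.comp w ((hasFDerivAt_id w).sub_const x)
  have h2 : HasFDerivAt (fun w : Space d => x + s • (w - x))
      (s • ContinuousLinearMap.id ℝ (Space d)) w :=
    (((hasFDerivAt_id w).sub_const x).const_smul s).const_add x
  have h3 : HasFDerivAt (fun w => (w - x) i * k (x + s • (w - x))) _ w :=
    h1.mul ((hk _).hasFDerivAt.comp w h2)
  rw [h3.fderiv]
  simp
  ring

theorem clm_apply_eq_sum_single (L : Space d →L[ℝ] ℝ) (v : Space d) :
    L v = ∑ i, v i * L (EuclideanSpace.single i 1) := by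
  have hv : ∑ i, v i • EuclideanSpace.single i (1 : ℝ) = v := by
    simpa using (EuclideanSpace.basisFun (Fin (d + 1)) ℝ).sum_repr v
  conv_lhs => rw [← hv]
  simp only [map_sum, map_smul, smul_eq_mul]

/-- The dilation derivative of an average is an average of the gradient: the test functions in the
definition of the weak gradient are `w ↦ (w - x)ᵢ k(x + s(w - x))`, whose divergence is, up to a
power of `s`, the `s`-derivative of the kernel `sⁿ k(x + s(w - x))`. -/
theorem HasWeakGradient.hasDerivAt_dilated_average {u : Space d → ℝ} {G : Space d → Space d}
    (h : HasWeakGradient u G) (hu : LocallyIntegrable ((doubleCone d).indicator u) volume)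
    (hk : ContDiff ℝ ∞ k) (hc : HasCompactSupport k) (hconv : Convex ℝ H)
    (hH : H ⊆ doubleCone d) (hx : x ∈ H) (hks : tsupport k ⊆ H) {s : ℝ} (hs : 1 ≤ s) :
    HasDerivAt (fun s => s ^ (d + 1) * ∫ w in doubleCone d, u w * k (x + s • (w - x)))
      (- (s ^ d * ∑ i, ∫ w in doubleCone d, G w i * ((w - x) i * k (x + s • (w - x))))) s := by
  have hkd : Differentiable ℝ k := hk.differentiable (by simp)
  have hcompact := hasCompactSupport_comp_dilation (x := x) hc hs
  have hsupp := (tsupport_comp_dilation_subset hconv hx hks hs).trans hH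
  have hcd : ContDiff ℝ ∞ fun w => k (x + s • (w - x)) := hk.comp (by fun_prop)
  obtain ⟨hint, hder⟩ := hasDerivAt_integral_mul_comp_dilation h.1 hu hk hc hconv hH hx hks hs
  refine ((hasDerivAt_pow (d + 1) s).mul hder).congr_deriv ?_
  -- Each coordinate contributes one test function.
  have hcθ (i : Fin (d + 1)) : ContDiff ℝ ∞ fun w => (w - x) i * k (x + s • (w - x)) :=
    ContDiff.mul (by fun_prop) hcd
  have hcompactθ (i : Fin (d + 1)) :
      HasCompactSupport fun w => (w - x) i * k (x + s • (w - x)) := hcompact.mul_left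
  have hsuppθ (i : Fin (d + 1)) :
      tsupport (fun w => (w - x) i * k (x + s • (w - x))) ⊆ doubleCone d :=
    tsupport_mul_subset_right.trans hsupp
  have hip (i : Fin (d + 1)) :
      ∫ w in doubleCone d, G w i * ((w - x) i * k (x + s • (w - x)))
        = - ∫ w in doubleCone d, u w * (k (x + s • (w - x))
          + s * ((w - x) i * fderiv ℝ k (x + s • (w - x)) (EuclideanSpace.single i 1))) := by
    have := h.3 (fun w => (w - x) i * k (x + s • (w - x)))
      (hcθ i) (hcompactθ i) (hsuppθ i) i
    simp only [fderiv_sub_apply_mul_comp_dilation hkd] at this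
    rw [this, neg_neg]
  have hi1 : Integrable (fun w => u w * k (x + s • (w - x))) (volume.restrict (doubleCone d)) :=
    integrable_mul_of_tsupport_subset h.1 hcd.continuous hcompact hsupp
  have hi2 (i : Fin (d + 1)) : Integrable (fun w => u w * (k (x + s • (w - x))
      + s * ((w - x) i * fderiv ℝ k (x + s • (w - x)) (EuclideanSpace.single i 1))))
      (volume.restrict (doubleCone d)) := by
    have := integrable_mul_of_tsupport_subset h.1 (continuous_fderiv_apply (hcθ i) _)
      ((hcompactθ i).fderiv_apply ℝ (EuclideanSpace.single i 1))
      ((tsupport_fderiv_apply_subset ℝ _).trans (hsuppθ i))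
    simpa only [fderiv_sub_apply_mul_comp_dilation hkd] using this
  rw [Finset.sum_congr rfl fun i _ => hip i, Finset.sum_neg_distrib,
    ← integral_finsetSum _ fun i _ => hi2 i]
  have hsum (w : Space d) : ∑ i, u w * (k (x + s • (w - x))
      + s * ((w - x) i * fderiv ℝ k (x + s • (w - x)) (EuclideanSpace.single i 1)))
      = (d + 1) * (u w * k (x + s • (w - x)))
        + s * (u w * fderiv ℝ k (x + s • (w - x)) (w - x)) := by
    rw [← Finset.mul_sum, Finset.sum_add_distrib, ← Finset.mul_sum, ← clm_apply_eq_sum_single]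
    simp only [Finset.sum_const, Finset.card_univ, Fintype.card_fin, nsmul_eq_mul]
    push_cast
    ring
  simp only [hsum]
  rw [integral_add (hi1.const_mul _) (hint.const_mul _), integral_const_mul, integral_const_mul]
  push_cast
  ring

/-- The maximal function bound on the gradient, in the form in which it enters the estimate of
the dilation derivative. -/
theorem enorm_integral_apply_mul_le {G : Space d → Space d} {R A l : ℝ} (hR : 0 < R)
    (hA : ∀ w, |k w| ≤ A) (hkR : tsupport k ⊆ Metric.closedBall x R)
    (hM : ∀ r, 0 < r → ∫⁻ w in Metric.closedBall x r, (doubleCone d).indicator (‖G ·‖ₑ) w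
      ≤ ENNReal.ofReal l * volume (Metric.closedBall x r)) {s : ℝ} (hs : 0 < s)
    (i : Fin (d + 1)) :
    ‖∫ w in doubleCone d, G w i * ((w - x) i * k (x + s • (w - x)))‖ₑ
      ≤ ENNReal.ofReal (R / s * A) * (ENNReal.ofReal l * volume (Metric.closedBall x (R / s))) := by
  refine (enorm_integral_le_lintegral_enorm _).trans ?_
  have hb : ∀ w, ‖G w i * ((w - x) i * k (x + s • (w - x)))‖ₑ
      ≤ ENNReal.ofReal (R / s * A) * (Metric.closedBall x (R / s)).indicator (‖G ·‖ₑ) w := by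
    intro w
    by_cases hw : w ∈ Metric.closedBall x (R / s)
    · rw [indicator_of_mem hw, enorm_mul, mul_comm]
      rw [mem_closedBall_iff_norm] at hw
      gcongr
      · rw [Real.enorm_eq_ofReal_abs, abs_mul]
        refine ENNReal.ofReal_le_ofReal ?_
        gcongr
        · exact (PiLp.norm_apply_le (w - x) i).trans hw
        · exact hA _
      · rw [enorm_le_iff_norm_le]
        exact PiLp.norm_apply_le (G w) i
    · rw [mem_closedBall_iff_norm, not_le] at hw
      rw [image_eq_zero_of_notMem_tsupport (notMem_tsupport_of_norm_sub_gt hkR hs hw)]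
      simp
  calc _ ≤ ∫⁻ w in doubleCone d, ENNReal.ofReal (R / s * A)
          * (Metric.closedBall x (R / s)).indicator (‖G ·‖ₑ) w := lintegral_mono hb
    _ = ENNReal.ofReal (R / s * A)
          * ∫⁻ w in Metric.closedBall x (R / s), (doubleCone d).indicator (‖G ·‖ₑ) w := by
        rw [lintegral_const_mul' _ _ ENNReal.ofReal_ne_top,
          setLIntegral_indicator Metric.isClosed_closedBall.measurableSet,
          setLIntegral_indicator measurableSet_doubleCone, inter_comm]
    _ ≤ _ := by gcongr; exact hM _ (by positivity)

/-- `x` is a Lebesgue point of the extension of `u` by zero. -/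
def IsLebesguePoint (u : Space d → ℝ) (x : Space d) : Prop :=
  Tendsto (fun r => ⨍ w in Metric.closedBall x r, ‖(doubleCone d).indicator u w - u x‖)
    (𝓝[>] 0) (𝓝 0)

theorem ae_isLebesguePoint {u : Space d → ℝ}
    (hu : LocallyIntegrable ((doubleCone d).indicator u) volume) :
    ∀ᵐ x ∂coneMeasure d, IsLebesguePoint u x := by
  have h := IsUnifLocDoublingMeasure.ae_tendsto_average_norm_sub (μ := volume) hu 1
  filter_upwards [ae_restrict_of_ae h, ae_mem_doubleCone] with x hx hxΩ
  have := hx (ι := ℝ) (l := 𝓝[>] 0) (fun _ => x) id tendsto_id (by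
    filter_upwards [self_mem_nhdsWithin] with r hr
    simpa using le_of_lt hr)
  rwa [indicator_of_mem hxΩ] at this

/-- Averages against kernels shrinking to a Lebesgue point converge to the value there. -/
theorem IsLebesguePoint.tendsto_dilated_average {u : Space d → ℝ} (hx : IsLebesguePoint u x)
    (hu : LocallyIntegrable ((doubleCone d).indicator u) volume) (hk : Continuous k)
    {R A : ℝ} (hR : 0 < R) (hA : ∀ w, |k w| ≤ A) (hkR : tsupport k ⊆ Metric.closedBall x R)
    (hk1 : ∫ w, k w = 1) :
    Tendsto (fun s : ℝ => s ^ (d + 1) * ∫ w in doubleCone d, u w * k (x + s • (w - x)))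
      atTop (𝓝 (u x)) := by
  set v := (doubleCone d).indicator u with hv
  have hA0 : 0 ≤ A := (abs_nonneg _).trans (hA 0)
  have hlim : Tendsto (fun s : ℝ => (A * volume.real (Metric.closedBall (0 : Space d) R))
      * ⨍ w in Metric.closedBall x (R / s), ‖v w - u x‖) atTop (𝓝 0) := by
    have h1 : Tendsto (fun s : ℝ => R / s) atTop (𝓝[>] 0) := by
      refine tendsto_nhdsWithin_iff.2 ⟨tendsto_const_nhds.div_atTop tendsto_id, ?_⟩
      filter_upwards [eventually_gt_atTop 0] with s hs
      exact div_pos hR hs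
    simpa using (Tendsto.comp hx h1).const_mul (A * volume.real (Metric.closedBall (0 : Space d) R))
  rw [tendsto_iff_norm_sub_tendsto_zero]
  refine squeeze_zero' (Eventually.of_forall fun _ => norm_nonneg _) ?_ hlim
  filter_upwards [eventually_ge_atTop 1] with s hs1
  have hs : 0 < s := by linarith
  have hkc : Continuous fun w => k (x + s • (w - x)) := by fun_prop
  have hksupp : HasCompactSupport fun w => k (x + s • (w - x)) :=
    hasCompactSupport_comp_dilation (HasCompactSupport.of_support_subset_isCompact
      (isCompact_closedBall x R) ((subset_tsupport k).trans hkR)) hs1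
  have hscale : s ^ (d + 1) * ∫ w, k (x + s • (w - x)) = 1 := by
    have e1 : ∫ w, k (x + s • (w - x)) = ∫ w, k (x + s • w) :=
      integral_sub_right_eq_self (fun w => k (x + s • w)) x
    have e2 : ∫ w, k (x + s • w) = _ := Measure.integral_comp_smul volume (fun w => k (x + w)) s
    rw [e1, e2, integral_add_left_eq_self, hk1, finrank_euclideanSpace, Fintype.card_fin,
      abs_of_pos (by positivity), smul_eq_mul, mul_one, mul_inv_cancel₀ (by positivity)]
  have hi1 : Integrable fun w => v w * k (x + s • (w - x)) := by
    have := hu.integrable_smul_right_of_hasCompactSupport hkc hksupp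
    simpa [mul_comm] using this
  have hi2 : Integrable fun w => u x * k (x + s • (w - x)) :=
    (hkc.integrable_of_hasCompactSupport hksupp).const_mul _
  have e : s ^ (d + 1) * (∫ w in doubleCone d, u w * k (x + s • (w - x))) - u x
      = s ^ (d + 1) * ∫ w, (v w - u x) * k (x + s • (w - x)) := by
    have e0 : ∫ w in doubleCone d, u w * k (x + s • (w - x)) = ∫ w, v w * k (x + s • (w - x)) := by
      rw [← integral_indicator measurableSet_doubleCone]
      congr 1; ext w
      by_cases hw : w ∈ doubleCone d <;> simp [hv, hw]
    simp only [sub_mul]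
    rw [e0, integral_sub hi1 hi2, integral_const_mul, mul_sub]
    linear_combination (u x) * hscale
  have hzero : ∀ w, w ∉ Metric.closedBall x (R / s) → (v w - u x) * k (x + s • (w - x)) = 0 := by
    intro w hw
    rw [mem_closedBall_iff_norm, not_le] at hw
    rw [image_eq_zero_of_notMem_tsupport (notMem_tsupport_of_norm_sub_gt hkR hs hw), mul_zero]
  have hvi : IntegrableOn (fun w => ‖v w - u x‖) (Metric.closedBall x (R / s)) :=
    ((hu.integrableOn_isCompact (isCompact_closedBall _ _)).sub
      (integrableOn_const (by exact measure_closedBall_lt_top.ne))).norm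
  have hvol : volume.real (Metric.closedBall x (R / s)) * s ^ (d + 1)
      = volume.real (Metric.closedBall (0 : Space d) R) := by
    rw [Measure.addHaar_real_closedBall _ _ (by positivity),
      Measure.addHaar_real_closedBall _ _ hR.le, finrank_euclideanSpace, Fintype.card_fin, div_pow]
    field_simp
  rw [e, norm_mul, Real.norm_of_nonneg (by positivity : (0 : ℝ) ≤ s ^ (d + 1)),
    ← setIntegral_eq_integral_of_forall_compl_eq_zero hzero]
  calc s ^ (d + 1) * ‖∫ w in Metric.closedBall x (R / s), (v w - u x) * k (x + s • (w - x))‖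
      ≤ s ^ (d + 1) * ∫ w in Metric.closedBall x (R / s), ‖v w - u x‖ * A := by
        gcongr
        refine norm_integral_le_of_norm_le (hvi.mul_const A) (ae_of_all _ fun w => ?_)
        rw [norm_mul]
        gcongr
        exact hA _
    _ = _ := by
        rw [integral_mul_const, setAverage_eq, smul_eq_mul, ← hvol]
        have : volume.real (Metric.closedBall x (R / s)) ≠ 0 :=
          (ENNReal.toReal_pos (Metric.measure_closedBall_pos _ _ (by positivity)).ne'
            measure_closedBall_lt_top.ne).ne'
        field_simp

/-- The mean value estimate: at a Lebesgue point `x` at which the maximal function of the gradient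
is at most `l`, the value of `u` is close to its average against any kernel `k` that is supported in
a convex part of the cone around `x`. -/
theorem HasWeakGradient.abs_integral_mul_sub_le {u : Space d → ℝ} {G : Space d → Space d}
    (h : HasWeakGradient u G) (hu : LocallyIntegrable ((doubleCone d).indicator u) volume)
    (hk : ContDiff ℝ ∞ k) (hconv : Convex ℝ H) (hH : H ⊆ doubleCone d) (hx : x ∈ H)
    (hks : tsupport k ⊆ H) {R A l : ℝ} (hR : 0 < R) (hl : 0 ≤ l) (hA : ∀ w, |k w| ≤ A)
    (hkR : tsupport k ⊆ Metric.closedBall x R) (hk1 : ∫ w, k w = 1) (hL : IsLebesguePoint u x)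
    (hM : ∀ r, 0 < r → ∫⁻ w in Metric.closedBall x r, (doubleCone d).indicator (‖G ·‖ₑ) w
      ≤ ENNReal.ofReal l * volume (Metric.closedBall x r)) :
    |u x - ∫ w in doubleCone d, u w * k w|
      ≤ (d + 1) * A * l * volume.real (Metric.ball (0 : Space d) 1) * R ^ (d + 2) := by
  have hA0 : 0 ≤ A := (abs_nonneg _).trans (hA 0)
  have hc : HasCompactSupport k := HasCompactSupport.of_support_subset_isCompact
      (isCompact_closedBall x R) ((subset_tsupport k).trans hkR)
  set β := volume.real (Metric.ball (0 : Space d) 1) with hβ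
  set C := (d + 1) * A * l * β * R ^ (d + 2) with hC
  set Ψ : ℝ → ℝ := fun s => s ^ (d + 1) * ∫ w in doubleCone d, u w * k (x + s • (w - x)) with hΨ
  have hC0 : 0 ≤ C := by positivity
  have hder (s : ℝ) (hs : 1 ≤ s) := h.hasDerivAt_dilated_average hu hk hc hconv hH hx hks hs
  have hbound (s : ℝ) (hs : 1 ≤ s) :
      ‖- (s ^ d * ∑ i, ∫ w in doubleCone d, G w i * ((w - x) i * k (x + s • (w - x))))‖
        ≤ C / s ^ 2 := by
    have hs0 : 0 < s := by linarith
    have hi (i : Fin (d + 1)) :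
        ‖∫ w in doubleCone d, G w i * ((w - x) i * k (x + s • (w - x)))‖
          ≤ (R / s * A) * (l * ((R / s) ^ (d + 1) * β)) := by
      have := ENNReal.toReal_mono (ENNReal.mul_ne_top ENNReal.ofReal_ne_top
        (ENNReal.mul_ne_top ENNReal.ofReal_ne_top measure_closedBall_lt_top.ne))
        (enorm_integral_apply_mul_le (G := G) hR hA hkR hM hs0 i)
      rw [toReal_enorm, ENNReal.toReal_mul, ENNReal.toReal_mul,
        ENNReal.toReal_ofReal (by positivity),
        ENNReal.toReal_ofReal hl, ← measureReal_def, Measure.addHaar_real_closedBall _ _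
        (by positivity), finrank_euclideanSpace, Fintype.card_fin] at this
      exact this
    rw [norm_neg, norm_mul, Real.norm_of_nonneg (by positivity : 0 ≤ s ^ d)]
    calc s ^ d * ‖∑ i, ∫ w in doubleCone d, G w i * ((w - x) i * k (x + s • (w - x)))‖
        ≤ s ^ d * ∑ _i : Fin (d + 1), (R / s * A) * (l * ((R / s) ^ (d + 1) * β)) := by
          gcongr
          exact norm_sum_le_of_le _ fun i _ => hi i
      _ = C / s ^ 2 := by
          rw [Finset.sum_const, Finset.card_univ, Fintype.card_fin, nsmul_eq_mul, hC, div_pow]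
          push_cast
          field_simp
          ring
  have hmain (S : ℝ) (hS : 1 ≤ S) : ‖Ψ S - Ψ 1‖ ≤ C := by
    have := image_norm_le_of_norm_deriv_right_le_deriv_boundary' (a := 1) (b := S)
      (f := fun s => Ψ s - Ψ 1) (B := fun s => C - C / s) (B' := fun s => C / s ^ 2)
      (fun s hs => ((hder s hs.1).sub_const _).continuousAt.continuousWithinAt)
      (fun s hs => ((hder s hs.1).sub_const _).hasDerivWithinAt) (by simp)
      (fun s hs => ContinuousAt.continuousWithinAt
        (by have : s ≠ 0 := by linarith [hs.1]
            fun_prop (disch := assumption)))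
      (fun s hs => by
        have hs0 : s ≠ 0 := by linarith [hs.1]
        refine HasDerivAt.hasDerivWithinAt ?_
        have := ((hasDerivAt_inv hs0).const_mul C).const_sub C
        simp only [← div_eq_mul_inv] at this
        convert this using 1
        field_simp)
      (fun s hs => hbound s hs.1) (right_mem_Icc.2 hS)
    refine this.trans ?_
    have : 0 ≤ C / S := by positivity
    linarith
  have hlim := (hL.tendsto_dilated_average hu hk.continuous hR hA hkR hk1).sub_const (Ψ 1)
  have h1 : Ψ 1 = ∫ w in doubleCone d, u w * k w := by simp [hΨ]
  rw [← h1, ← Real.norm_eq_abs]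
  exact le_of_tendsto hlim.norm ((eventually_ge_atTop 1).mono hmain)

end Ray

/-- A weakly differentiable function is Lipschitz on the set of Lebesgue points in half of the cone
where the maximal function of its gradient is bounded by `l`. Two such points `x` and `y` are
compared with the average over a ball of radius comparable to `|x - y|` which is reached by
moving from `x` into the cone. -/
theorem HasWeakGradient.abs_sub_le_mul_norm_sub {u : Space d → ℝ} {G : Space d → Space d}
    (h : HasWeakGradient u G) (hu : LocallyIntegrable ((doubleCone d).indicator u) volume)
    {σ : ℝ} (hσ : σ ^ 2 = 1) {l : ℝ} (hl : 0 ≤ l) {x y : Space d} (hx : x ∈ halfCone d σ)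
    (hy : y ∈ halfCone d σ) (hLx : IsLebesguePoint u x) (hLy : IsLebesguePoint u y)
    (hMx : ∀ r, 0 < r → ∫⁻ w in Metric.closedBall x r, (doubleCone d).indicator (‖G ·‖ₑ) w
      ≤ ENNReal.ofReal l * volume (Metric.closedBall x r))
    (hMy : ∀ r, 0 < r → ∫⁻ w in Metric.closedBall y r, (doubleCone d).indicator (‖G ·‖ₑ) w
      ≤ ENNReal.ofReal l * volume (Metric.closedBall y r)) :
    |u x - u y| ≤ 2 * (d + 1) * 3 ^ (d + 2) * 4 ^ (d + 1) * l * ‖x - y‖ := by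
  rcases eq_or_ne x y with rfl | hne
  · simp
  set r := ‖x - y‖ with hr
  have hr0 : 0 < r := norm_sub_pos_iff.2 hne
  -- The ball of radius `r / 2` around `c` lies in the half cone and within `3 r` of `x` and `y`.
  set c : Space d := x + (r * σ) • EuclideanSpace.single (Fin.last d) 1 with hc
  let b : ContDiffBump c := ⟨r / 4, r / 2, by positivity, by linarith⟩
  have hb : tsupport (b.normed volume) = Metric.closedBall c (r / 2) := b.tsupport_normed_eq
  have hcx : dist c x ≤ r := by
    have : |σ| = 1 := by
      rcases eq_or_eq_neg_of_sq_eq_sq σ 1 (by rw [hσ, one_pow]) with rfl | rfl <;> simp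
    rw [hc, dist_eq_norm, add_sub_cancel_left, norm_smul, norm_mul, Real.norm_eq_abs σ, this,
      Real.norm_of_nonneg hr0.le]
    simp
  have hcy : dist c y ≤ 2 * r := by
    have := dist_triangle c x y
    rw [dist_eq_norm x y] at this
    linarith
  set β := volume.real (Metric.ball (0 : Space d) 1) with hβ
  have hβ0 : 0 < β := ENNReal.toReal_pos (Metric.measure_ball_pos _ _ one_pos).ne'
    measure_ball_lt_top.ne
  have hA (w : Space d) : |b.normed volume w| ≤ 1 / ((r / 4) ^ (d + 1) * β) := by
    rw [abs_of_nonneg (b.nonneg_normed w)]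
    refine (b.normed_le_div_measure_closedBall_rIn volume w).trans (le_of_eq ?_)
    rw [Measure.addHaar_real_closedBall _ _ b.rIn_pos.le, finrank_euclideanSpace, Fintype.card_fin]
  have key (z : Space d) (hz : z ∈ halfCone d σ) (hcz : dist c z ≤ 2 * r)
      (hLz : IsLebesguePoint u z)
      (hMz : ∀ r, 0 < r → ∫⁻ w in Metric.closedBall z r, (doubleCone d).indicator (‖G ·‖ₑ) w
        ≤ ENNReal.ofReal l * volume (Metric.closedBall z r)) :
      |u z - ∫ w in doubleCone d, u w * b.normed volume w|
        ≤ (d + 1) * 3 ^ (d + 2) * 4 ^ (d + 1) * l * r := by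
    refine (h.abs_integral_mul_sub_le hu (b.contDiff_normed (n := ⊤)) (convex_halfCone σ)
      (halfCone_subset_doubleCone hσ) hz (hb.subset.trans (closedBall_subset_halfCone hσ hx r))
      (R := 3 * r) (by positivity) hl hA
      (hb.subset.trans (Metric.closedBall_subset_closedBall' (by linarith)))
      b.integral_normed hLz hMz).trans (le_of_eq ?_)
    rw [← hβ, div_pow, mul_pow]
    field_simp
    ring
  calc |u x - u y| ≤ |u x - ∫ w in doubleCone d, u w * b.normed volume w|
        + |u y - ∫ w in doubleCone d, u w * b.normed volume w| := by
        rw [abs_sub_comm (u y)]; exact _root_.abs_sub_le _ _ _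
    _ ≤ _ := add_le_add (key x hx (by linarith) hLx hMx) (key y hy hcy hLy hMy)
    _ = _ := by ring

/-! ### The gradient on a level set -/

/-- For a Lipschitz function `v`, testing the gradient of `ε arctan (v / ε)`, a function bounded by
`2 ε`, shows that the gradient of `v` near the zero set of `v` almost cancels on average. -/
theorem abs_integral_inv_one_add_sq_mul_gradient_le {K : ℝ≥0} {v : Space d → ℝ}
    (hv : LipschitzWith K v) {ε : ℝ} (hε : 0 < ε) {φ : Space d → ℝ} (h1 : ContDiff ℝ ∞ φ)
    (h2 : HasCompactSupport φ) (h3 : tsupport φ ⊆ doubleCone d) (i : Fin (d + 1)) :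
    |∫ x in doubleCone d, (1 + (v x / ε) ^ 2)⁻¹ * (gradient v x i * φ x)|
      ≤ 2 * ε * ∫ x in doubleCone d, |fderiv ℝ φ x (EuclideanSpace.single i 1)| := by
  have hl : LipschitzWith 1 Real.arctan := lipschitzWith_of_nnnorm_deriv_le
    Real.differentiable_arctan fun x => by
      rw [← NNReal.coe_le_coe, coe_nnnorm, Real.deriv_arctan, Real.norm_of_nonneg (by positivity),
        NNReal.coe_one, div_le_one (by positivity)]
      nlinarith [sq_nonneg x]
  have hψ : LipschitzWith (‖ε‖₊ * (1 * (‖ε⁻¹‖₊ * K))) fun x => ε * Real.arctan (ε⁻¹ * v x) :=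
    ((lipschitzWith_smul ε).comp (hl.comp ((lipschitzWith_smul ε⁻¹).comp hv)) :)
  have hw := (hasWeakGradient_gradient hψ).3 φ h1 h2 h3 i
  have e : ∫ x in doubleCone d, (1 + (v x / ε) ^ 2)⁻¹ * (gradient v x i * φ x)
      = ∫ x in doubleCone d, gradient (fun x => ε * Real.arctan (ε⁻¹ * v x)) x i * φ x := by
    refine integral_congr_ae ?_
    filter_upwards [ae_restrict_of_ae (hv.ae_differentiableAt (μ := volume))] with x hx
    have h := ((hx.hasFDerivAt.const_mul ε⁻¹).arctan).const_mul ε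
    rw [gradient_apply, gradient_apply, h.fderiv]
    simp only [smul_apply, smul_eq_mul]
    field_simp
  have hc := continuous_fderiv_apply h1 (EuclideanSpace.single i 1)
  have hi : Integrable (fun x => fderiv ℝ φ x (EuclideanSpace.single i 1))
      (volume.restrict (doubleCone d)) :=
    (hc.integrable_of_hasCompactSupport (h2.fderiv_apply ℝ _)).restrict
  rw [e, ← neg_neg (∫ x in doubleCone d, _), ← hw, abs_neg, ← Real.norm_eq_abs,
    ← integral_const_mul]
  refine norm_integral_le_of_norm_le (hi.abs.const_mul _) (ae_of_all _ fun x => ?_)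
  rw [norm_mul, Real.norm_eq_abs, Real.norm_eq_abs]
  gcongr
  rw [abs_mul, abs_of_pos hε, mul_comm 2]
  gcongr
  have := Real.arctan_lt_pi_div_two (ε⁻¹ * v x)
  have := Real.neg_pi_div_two_lt_arctan (ε⁻¹ * v x)
  have := Real.pi_le_four
  rw [abs_le]; constructor <;> linarith

/-- The gradient of a limit of Lipschitz functions vanishes almost everywhere on its zero set. -/
theorem HasWeakGradient.ae_eq_zero_of_eq_zero {u : Space d → ℝ} {G : Space d → Space d}
    (h : HasWeakGradient u G)
    (happ : ∀ ε : ℝ≥0∞, 0 < ε → ∃ v, LipschitzOnCone v ∧ normW1 1 (fun x => u x - v x) ≤ ε) :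
    ∀ᵐ x ∂coneMeasure d, u x = 0 → G x = 0 := by
  have hum : AEStronglyMeasurable u (coneMeasure d) := h.1.aestronglyMeasurable
  have hGm : AEStronglyMeasurable G (coneMeasure d) := h.2.aestronglyMeasurable
  have hex (n : ℕ) : ∃ (v : Space d → ℝ) (K : ℝ≥0), LipschitzWith K v ∧
      eLpNorm (fun x => u x - v x) 1 (coneMeasure d) ≤ (n + 1 : ℝ≥0∞)⁻¹ ∧
      eLpNorm (fun x => G x - gradient v x) 1 (coneMeasure d) ≤ (n + 1 : ℝ≥0∞)⁻¹ := by
    obtain ⟨v, hv, hn⟩ := happ (n + 1 : ℝ≥0∞)⁻¹ (by simp)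
    obtain ⟨K, g, hg, hvg⟩ := hv.exists_extension
    have hvg := ae_eq_of_eqOn_closedDoubleCone hvg
    have hw : HasWeakGradient (fun x => u x - v x) (fun x => G x - gradient g x) :=
      (h.sub (hasWeakGradient_gradient hg)).congr
        (by filter_upwards [hvg] with x hx; rw [hx]) .rfl
    rw [hw.normW1_eq] at hn
    refine ⟨g, K, hg, ?_, le_add_self.trans hn⟩
    refine le_trans (le_of_eq (eLpNorm_congr_ae ?_)) (le_self_add.trans hn)
    filter_upwards [hvg] with x hx; rw [hx]
  choose v K hv hv1 hv2 using hex
  have hlim0 : Tendsto (fun n : ℕ => (n + 1 : ℝ≥0∞)⁻¹) atTop (𝓝 0) := by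
    have := ENNReal.tendsto_inv_nat_nhds_zero.comp (tendsto_add_atTop_nat 1)
    refine this.congr fun n => by simp
  have hmeas : TendstoInMeasure (coneMeasure d) v atTop u := by
    refine tendstoInMeasure_of_tendsto_eLpNorm one_ne_zero
      (fun n => (hv n).continuous.aestronglyMeasurable) hum ?_
    refine tendsto_of_tendsto_of_tendsto_of_le_of_le tendsto_const_nhds hlim0
      (fun _ => zero_le) fun n => ?_
    rw [eLpNorm_sub_comm]
    exact hv1 n
  obtain ⟨ns, hns, hae⟩ := hmeas.exists_seq_tendsto_ae
  have hφG {φ : Space d → ℝ} (h1 : ContDiff ℝ ∞ φ) (h2 : HasCompactSupport φ)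
      (h3 : tsupport φ ⊆ doubleCone d) (i : Fin (d + 1)) :
      Integrable (fun x => G x i * φ x) (coneMeasure d) :=
    integrable_mul_of_tsupport_subset (locallyIntegrableOn_apply h.2 i) h1.continuous h2 h3
  have hle1 (a : ℝ) : ‖(1 + a ^ 2)⁻¹‖ ≤ 1 := by
    rw [Real.norm_of_nonneg (by positivity)]
    exact inv_le_one_of_one_le₀ (by nlinarith [sq_nonneg a])
  -- Pass to the limit along the approximating sequence.
  have hstep {φ : Space d → ℝ} (h1 : ContDiff ℝ ∞ φ) (h2 : HasCompactSupport φ)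
      (h3 : tsupport φ ⊆ doubleCone d) (i : Fin (d + 1)) {ε : ℝ} (hε : 0 < ε) :
      |∫ x, (1 + (u x / ε) ^ 2)⁻¹ * (G x i * φ x) ∂coneMeasure d|
        ≤ 2 * ε * ∫ x in doubleCone d, |fderiv ℝ φ x (EuclideanSpace.single i 1)| := by
    obtain ⟨M, hM⟩ := h2.exists_bound_of_continuous h1.continuous
    have hM0 : 0 ≤ M := (norm_nonneg _).trans (hM 0)
    have hl1 : Tendsto (fun j => ∫ x, (1 + (v (ns j) x / ε) ^ 2)⁻¹ * (G x i * φ x) ∂coneMeasure d)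
        atTop (𝓝 (∫ x, (1 + (u x / ε) ^ 2)⁻¹ * (G x i * φ x) ∂coneMeasure d)) := by
      refine tendsto_integral_of_dominated_convergence (fun x => ‖G x i * φ x‖) (fun j => ?_)
        (hφG h1 h2 h3 i).norm (fun j => ae_of_all _ fun x => ?_) ?_
      · refine AEStronglyMeasurable.mul ?_ (hφG h1 h2 h3 i).1
        have := (hv (ns j)).continuous
        exact (Continuous.inv₀ (by fun_prop) (fun x => by positivity)).aestronglyMeasurable
      · rw [norm_mul]
        exact mul_le_of_le_one_left (norm_nonneg _) (hle1 _)
      · filter_upwards [hae] with x hx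
        refine Tendsto.mul_const _ (Tendsto.inv₀ ?_ (by positivity))
        exact ((hx.div_const ε).pow 2).const_add 1
    have hl2 : Tendsto (fun j : ℕ => 2 * ε * (∫ x in doubleCone d,
        |fderiv ℝ φ x (EuclideanSpace.single i 1)|) + M * ((ns j + 1 : ℝ≥0∞)⁻¹).toReal) atTop
        (𝓝 (2 * ε * (∫ x in doubleCone d,
          |fderiv ℝ φ x (EuclideanSpace.single i 1)|) + M * 0)) := by
      refine Tendsto.const_add _ (Tendsto.const_mul _ ?_)
      exact (ENNReal.tendsto_toReal ENNReal.zero_ne_top).comp (hlim0.comp hns.tendsto_atTop)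
    rw [mul_zero, add_zero] at hl2
    refine le_of_tendsto_of_tendsto' hl1.abs hl2 fun j => ?_
    set n := ns j with hn
    have hd1 := abs_integral_inv_one_add_sq_mul_gradient_le (hv n) hε h1 h2 h3 i
    have hiv : Integrable (fun x => (1 + (v n x / ε) ^ 2)⁻¹ * (gradient (v n) x i * φ x))
        (coneMeasure d) := by
      have hg := integrable_mul_of_tsupport_subset
        (locallyIntegrableOn_apply (hasWeakGradient_gradient (hv n)).2 i) h1.continuous h2 h3
      refine hg.bdd_mul (c := 1) ?_ (ae_of_all _ fun x => hle1 _)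
      have := (hv n).continuous
      exact (Continuous.inv₀ (by fun_prop) (fun x => by positivity)).aestronglyMeasurable
    have hiG : Integrable (fun x => (1 + (v n x / ε) ^ 2)⁻¹ * (G x i * φ x)) (coneMeasure d) := by
      refine (hφG h1 h2 h3 i).bdd_mul (c := 1) ?_ (ae_of_all _ fun x => hle1 _)
      have := (hv n).continuous
      exact (Continuous.inv₀ (by fun_prop) (fun x => by positivity)).aestronglyMeasurable
    have hd2 : |∫ x, (1 + (v n x / ε) ^ 2)⁻¹ * (G x i * φ x) ∂coneMeasure d
        - ∫ x, (1 + (v n x / ε) ^ 2)⁻¹ * (gradient (v n) x i * φ x) ∂coneMeasure d|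
        ≤ M * ((n + 1 : ℝ≥0∞)⁻¹).toReal := by
      rw [← integral_sub hiG hiv, ← Real.norm_eq_abs]
      have hdi : Integrable (fun x => G x - gradient (v n) x) (coneMeasure d) :=
        memLp_one_iff_integrable.1 ⟨hGm.sub (measurable_gradient _).aestronglyMeasurable,
          (hv2 n).trans_lt (by simp)⟩
      have hnorm : ∫ x, ‖G x - gradient (v n) x‖ ∂coneMeasure d
          ≤ ((n + 1 : ℝ≥0∞)⁻¹).toReal := by
        rw [integral_norm_eq_lintegral_enorm hdi.1, ← eLpNorm_one_eq_lintegral_enorm]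
        exact ENNReal.toReal_mono (by simp) (hv2 n)
      refine (norm_integral_le_of_norm_le (hdi.norm.const_mul M) (ae_of_all _ fun x => ?_)).trans ?_
      · rw [← mul_sub, ← sub_mul, norm_mul, norm_mul, mul_comm M]
        refine (mul_le_of_le_one_left (by positivity) (hle1 _)).trans ?_
        gcongr
        · exact PiLp.norm_apply_le (G x - gradient (v n) x) i
        · exact hM x
      · rw [integral_const_mul]
        gcongr
    have := abs_sub_abs_le_abs_sub
      (∫ x, (1 + (v n x / ε) ^ 2)⁻¹ * (G x i * φ x) ∂coneMeasure d)
      (∫ x, (1 + (v n x / ε) ^ 2)⁻¹ * (gradient (v n) x i * φ x) ∂coneMeasure d)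
    change |∫ x, (1 + (v n x / ε) ^ 2)⁻¹ * (gradient (v n) x i * φ x) ∂coneMeasure d| ≤ _ at hd1
    linarith
  have hZ : NullMeasurableSet {x | u x = 0} (coneMeasure d) :=
    nullMeasurableSet_eq_fun hum.aemeasurable aemeasurable_const
  have hFm : AEStronglyMeasurable ({x | u x = 0}.indicator G) (coneMeasure d) :=
    hGm.indicator₀ hZ
  have hFloc : LocallyIntegrableOn ({x | u x = 0}.indicator G) (doubleCone d) volume := by
    intro x hx
    obtain ⟨s, hs, hi⟩ := h.2 x hx
    refine ⟨s ∩ doubleCone d, inter_mem hs self_mem_nhdsWithin, ?_⟩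
    refine Integrable.mono (hi.mono_set inter_subset_left)
      (hFm.mono_measure (Measure.restrict_mono inter_subset_right le_rfl)) (ae_of_all _ fun y => ?_)
    exact norm_indicator_le_norm_self G y
  have hfin := ae_eq_zero_of_forall_integral_apply_mul_eq_zero hFloc fun φ h1 h2 h3 i => by
    set B := ∫ x in doubleCone d, |fderiv ℝ φ x (EuclideanSpace.single i 1)|
    have hε0 : Tendsto (fun n : ℕ => (1 : ℝ) / (n + 1)) atTop (𝓝 0) :=
      tendsto_one_div_add_atTop_nhds_zero_nat
    have hl1 : Tendsto (fun n : ℕ => ∫ x, (1 + (u x / (1 / (n + 1))) ^ 2)⁻¹ * (G x i * φ x)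
        ∂coneMeasure d) atTop
        (𝓝 (∫ x, ({x | u x = 0}.indicator G) x i * φ x ∂coneMeasure d)) := by
      refine tendsto_integral_of_dominated_convergence (fun x => ‖G x i * φ x‖) (fun j => ?_)
        (hφG h1 h2 h3 i).norm (fun j => ae_of_all _ fun x => ?_) (ae_of_all _ fun x => ?_)
      · refine AEStronglyMeasurable.mul ?_ (hφG h1 h2 h3 i).1
        exact (((hum.aemeasurable.div_const _).pow_const 2).const_add 1).inv.aestronglyMeasurable
      · rw [norm_mul]
        exact mul_le_of_le_one_left (norm_nonneg _) (hle1 _)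
      · by_cases hx : u x = 0
        · have hx' : x ∈ {x | u x = 0} := hx
          rw [indicator_of_mem hx']
          simp [hx]
        · have hx' : x ∉ {x | u x = 0} := hx
          rw [indicator_of_notMem hx']
          have : Tendsto (fun n : ℕ => (1 + (u x / (1 / ((n : ℝ) + 1))) ^ 2)⁻¹) atTop (𝓝 0) := by
            refine tendsto_inv_atTop_zero.comp (tendsto_atTop_add_const_left _ _ ?_)
            have h1 : Tendsto (fun n : ℕ => (u x) ^ 2 * ((n : ℝ) + 1) ^ 2) atTop atTop :=
              Tendsto.const_mul_atTop (by positivity) ((tendsto_pow_atTop two_ne_zero).comp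
                (tendsto_atTop_add_const_right _ _ tendsto_natCast_atTop_atTop))
            refine h1.congr fun n => ?_
            rw [div_div_eq_mul_div, div_one, mul_pow]
          simpa using this.mul_const (G x i * φ x)
    have hl2 : Tendsto (fun n : ℕ => 2 * ((1 : ℝ) / (n + 1)) * B) atTop (𝓝 (2 * 0 * B)) :=
      (hε0.const_mul 2).mul_const B
    have := le_of_tendsto_of_tendsto' hl1.abs hl2 fun n => hstep h1 h2 h3 i (by positivity)
    rw [mul_zero, zero_mul] at this
    exact abs_nonpos_iff.1 this
  filter_upwards [hfin] with x hx h0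
  rwa [indicator_of_mem (show x ∈ {x | u x = 0} from h0)] at hx

/-! ### Membership in `H¹₁(X)` -/

theorem lipschitzWith_mul_of_bounded {K L B M : ℝ≥0} {f g : Space d → ℝ} (hf : LipschitzWith K f)
    (hg : LipschitzWith L g) (hfB : ∀ x, |f x| ≤ B) (hgM : ∀ x, |g x| ≤ M) :
    LipschitzWith (B * L + M * K) fun x => f x * g x := by
  refine LipschitzWith.of_dist_le_mul fun x y => ?_
  have h1 := hf.dist_le_mul x y
  have h2 := hg.dist_le_mul x y
  rw [Real.dist_eq] at h1 h2 ⊢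
  calc |f x * g x - f y * g y| = |f x * (g x - g y) + g y * (f x - f y)| := by congr 1; ring
    _ ≤ |f x| * |g x - g y| + |g y| * |f x - f y| := by
        rw [← abs_mul, ← abs_mul]; exact abs_add_le _ _
    _ ≤ B * (L * dist x y) + M * (K * dist x y) := by
        gcongr
        · exact hfB x
        · exact hgM y
    _ = _ := by push_cast; ring

/-- The cutoff which vanishes on the ball of radius `R` and equals `1` off the ball of
radius `2 R`. -/
def outerCutoff (R : ℝ) (x : Space d) : ℝ := max 0 (min 1 (R⁻¹ * ‖x‖ - 1))

theorem outerCutoff_nonneg (R : ℝ) (x : Space d) : 0 ≤ outerCutoff R x := le_max_left _ _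

theorem outerCutoff_le_one (R : ℝ) (x : Space d) : outerCutoff R x ≤ 1 :=
  max_le zero_le_one (min_le_left _ _)

theorem outerCutoff_eq_zero {R : ℝ} (hR : 0 < R) {x : Space d} (hx : ‖x‖ ≤ R) :
    outerCutoff R x = 0 := by
  refine max_eq_left ((min_le_right _ _).trans ?_)
  rw [sub_nonpos, inv_mul_le_iff₀ hR, mul_one]
  exact hx

theorem outerCutoff_eq_one {R : ℝ} (hR : 0 < R) {x : Space d} (hx : 2 * R ≤ ‖x‖) :
    outerCutoff R x = 1 := by
  have : 1 ≤ R⁻¹ * ‖x‖ - 1 := by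
    rw [le_sub_iff_add_le, le_inv_mul_iff₀ hR]
    linarith
  rw [outerCutoff, min_eq_left this, max_eq_right zero_le_one]

theorem lipschitzWith_outerCutoff {R : ℝ} (hR : 0 < R) :
    LipschitzWith (Real.toNNReal R⁻¹) (outerCutoff R : Space d → ℝ) := by
  have h : LipschitzWith (Real.toNNReal R⁻¹) fun x : Space d => R⁻¹ * ‖x‖ - 1 := by
    refine LipschitzWith.of_dist_le_mul fun x y => ?_
    rw [Real.dist_eq, sub_sub_sub_cancel_right, ← mul_sub, abs_mul, abs_of_pos (by positivity),
      Real.coe_toNNReal _ (by positivity), dist_eq_norm]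
    gcongr
    exact abs_norm_sub_norm_le x y
  exact (h.const_min 1).const_max 0

theorem norm_gradient_mul_le {f g : Space d → ℝ} {x : Space d} (hf : DifferentiableAt ℝ f x)
    (hg : DifferentiableAt ℝ g x) :
    ‖gradient (fun x => f x * g x) x‖ ≤ |f x| * ‖gradient g x‖ + |g x| * ‖gradient f x‖ := by
  have h : fderiv ℝ (fun x => f x * g x) x = f x • fderiv ℝ g x + g x • fderiv ℝ f x :=
    (hf.hasFDerivAt.mul hg.hasFDerivAt).fderiv
  simp only [gradient, LinearIsometryEquiv.norm_map]
  rw [h, ← Real.norm_eq_abs, ← Real.norm_eq_abs, ← norm_smul, ← norm_smul]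
  exact norm_add_le _ _

theorem eLpNorm_gradient_mul_outerCutoff_le {K : ℝ≥0} {w : Space d → ℝ} (hw : LipschitzWith K w)
    {R : ℝ} (hR : 0 < R) :
    eLpNorm (gradient fun x => w x * outerCutoff R x) 1 (coneMeasure d)
      ≤ ENNReal.ofReal R⁻¹ * eLpNorm w 1 (coneMeasure d)
        + ∫⁻ x, ENNReal.ofReal (outerCutoff R x) * ‖gradient w x‖ₑ ∂coneMeasure d := by
  rw [eLpNorm_one_eq_lintegral_enorm, eLpNorm_one_eq_lintegral_enorm,
    ← lintegral_const_mul _ hw.continuous.measurable.enorm,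
    ← lintegral_add_left (by have := hw.continuous; fun_prop)]
  refine lintegral_mono_ae ?_
  have hη := lipschitzWith_outerCutoff (d := d) hR
  filter_upwards [ae_restrict_of_ae (hw.ae_differentiableAt (μ := volume)),
    ae_restrict_of_ae (hη.ae_differentiableAt (μ := volume))] with x h1 h2
  have h3 := norm_gradient_mul_le h1 h2
  have h4 := norm_gradient_le hη x
  rw [Real.coe_toNNReal _ (by positivity)] at h4
  rw [abs_of_nonneg (outerCutoff_nonneg R x)] at h3
  rw [← ofReal_norm, ← ofReal_norm, ← ofReal_norm, ← ENNReal.ofReal_mul (by positivity),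
    ← ENNReal.ofReal_mul (outerCutoff_nonneg R x), ← ENNReal.ofReal_add (by positivity)
      (mul_nonneg (outerCutoff_nonneg R x) (norm_nonneg _)), Real.norm_eq_abs]
  refine ENNReal.ofReal_le_ofReal (h3.trans ?_)
  rw [mul_comm R⁻¹]
  gcongr

theorem tendsto_lintegral_outerCutoff_mul {F : Space d → ℝ≥0∞} (hF : Measurable F)
    (hfin : ∫⁻ x, F x ∂coneMeasure d ≠ ⊤) :
    Tendsto (fun n : ℕ => ∫⁻ x, ENNReal.ofReal (outerCutoff ((n : ℝ) + 1) x) * F x ∂coneMeasure d)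
      atTop (𝓝 0) := by
  have := tendsto_lintegral_of_dominated_convergence (μ := coneMeasure d) (f := fun _ => 0)
    (F := fun (n : ℕ) x => ENNReal.ofReal (outerCutoff ((n : ℝ) + 1) x) * F x) F
    (fun n => ((lipschitzWith_outerCutoff (d := d) (R := (n : ℝ) + 1)
      (by positivity)).continuous.measurable.ennreal_ofReal).mul hF)
    (fun n => ae_of_all _ fun x => by
      refine mul_le_of_le_one_left' ?_
      rw [← ENNReal.ofReal_one]
      exact ENNReal.ofReal_le_ofReal (outerCutoff_le_one _ x)) hfin
    (ae_of_all _ fun x => by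
      refine tendsto_const_nhds.congr' ?_
      filter_upwards [eventually_ge_atTop ⌈‖x‖⌉₊] with n hn
      have : ‖x‖ ≤ (n : ℝ) + 1 := (Nat.ceil_le.1 hn).trans (by linarith)
      rw [outerCutoff_eq_zero (by positivity) this]
      simp)
  simpa using this

theorem memLipZero_mul_one_sub_outerCutoff {K B : ℝ≥0} {w : Space d → ℝ} (hw : LipschitzWith K w)
    (hB : ∀ x, |w x| ≤ B) {R : ℝ} (hR : 0 < R) :
    MemLipZero fun x => w x - w x * outerCutoff R x := by
  have hη (x : Space d) : |outerCutoff R x| ≤ (1 : ℝ≥0) := by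
    rw [abs_of_nonneg (outerCutoff_nonneg R x)]; exact outerCutoff_le_one R x
  refine ⟨(hw.sub (lipschitzWith_mul_of_bounded hw
    (lipschitzWith_outerCutoff hR) hB hη)).lipschitzOnCone, ?_⟩
  refine HasCompactSupport.intro ((isClosed_closure (s :=
    doubleCone d)).isClosedEmbedding_subtypeVal.isCompact_preimage
    (isCompact_closedBall (0 : Space d) (2 * R))) fun x hx => ?_
  have hx' : 2 * R ≤ ‖(x : Space d)‖ := by
    by_contra! hlt
    exact hx (mem_closedBall_zero_iff.2 hlt.le)
  change w x - w x * outerCutoff R (x : Space d) = 0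
  rw [outerCutoff_eq_one hR hx']
  ring

/-- A bounded Lipschitz function in `W¹₁(Ω)` is approximated by its truncations at infinity. -/
theorem exists_memLipZero_normW1_sub_le {K B : ℝ≥0} {w : Space d → ℝ} (hw : LipschitzWith K w)
    (hB : ∀ x, |w x| ≤ B) (hi : eLpNorm w 1 (coneMeasure d) ≠ ⊤)
    (hgi : eLpNorm (gradient w) 1 (coneMeasure d) ≠ ⊤) {ε : ℝ≥0∞} (hε : 0 < ε) :
    ∃ g, MemLipZero g ∧ normW1 1 (fun x => w x - g x) ≤ ε := by
  have hη (R : ℝ) (x : Space d) : |outerCutoff R x| ≤ (1 : ℝ≥0) := by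
    rw [abs_of_nonneg (outerCutoff_nonneg R x)]; exact outerCutoff_le_one R x
  have h1 := tendsto_lintegral_outerCutoff_mul (d := d) hw.continuous.measurable.enorm
    (by rwa [← eLpNorm_one_eq_lintegral_enorm])
  have h2 := tendsto_lintegral_outerCutoff_mul (d := d) (measurable_gradient w).enorm
    (by rwa [← eLpNorm_one_eq_lintegral_enorm])
  have h3 : Tendsto (fun n : ℕ => ENNReal.ofReal ((n : ℝ) + 1)⁻¹ * eLpNorm w 1 (coneMeasure d))
      atTop (𝓝 0) := by
    have h0 : Tendsto (fun n : ℕ => ENNReal.ofReal ((n : ℝ) + 1)⁻¹) atTop (𝓝 0) := by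
      have := ENNReal.tendsto_ofReal (tendsto_one_div_add_atTop_nhds_zero_nat (𝕜 := ℝ))
      simpa using this
    simpa using ENNReal.Tendsto.mul_const h0 (Or.inr hi)
  have hlim := h1.add (h3.add h2)
  rw [add_zero, add_zero] at hlim
  obtain ⟨n, hn⟩ := (hlim.eventually (ge_mem_nhds hε)).exists
  have hR : (0 : ℝ) < (n : ℝ) + 1 := by positivity
  refine ⟨_, memLipZero_mul_one_sub_outerCutoff hw hB hR, ?_⟩
  simp only [sub_sub_cancel]
  rw [(hasWeakGradient_gradient (lipschitzWith_mul_of_bounded hw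
    (lipschitzWith_outerCutoff hR) hB (hη _))).normW1_eq]
  refine (add_le_add ?_ (eLpNorm_gradient_mul_outerCutoff_le hw hR)).trans hn
  rw [eLpNorm_one_eq_lintegral_enorm]
  refine le_of_eq (lintegral_congr fun x => ?_)
  rw [enorm_mul, mul_comm, Real.enorm_of_nonneg (outerCutoff_nonneg _ x)]

theorem MemLipZero.add {f g : Space d → ℝ} (hf : MemLipZero f) (hg : MemLipZero g) :
    MemLipZero fun x => f x + g x := by
  obtain ⟨⟨K, hK⟩, hfc⟩ := hf
  obtain ⟨⟨L, hL⟩, hgc⟩ := hg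
  exact ⟨⟨K + L, hK.add hL⟩, hfc.add hgc⟩

theorem normW1_add_le {f g : Space d → ℝ} {G H : Space d → Space d}
    (hf : HasWeakGradient f G) (hg : HasWeakGradient g H) :
    normW1 1 (fun x => f x + g x) ≤ normW1 1 f + normW1 1 g := by
  rw [hf.normW1_eq, hg.normW1_eq, (hf.add hg).normW1_eq]
  have h1 : eLpNorm (fun x => f x + g x) 1 (coneMeasure d) ≤ _ :=
    eLpNorm_add_le hf.1.aestronglyMeasurable hg.1.aestronglyMeasurable le_rfl
  have h2 : eLpNorm (fun x => G x + H x) 1 (coneMeasure d) ≤ _ :=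
    eLpNorm_add_le hf.2.aestronglyMeasurable hg.2.aestronglyMeasurable le_rfl
  exact (add_le_add h1 h2).trans_eq (add_add_add_comm _ _ _ _)

theorem normW1_congr {p : ℝ≥0∞} {f g : Space d → ℝ} {G : Space d → Space d}
    (hf : HasWeakGradient f G) (h : f =ᵐ[coneMeasure d] g) : normW1 p f = normW1 p g := by
  rw [hf.normW1_eq, (hf.congr h .rfl).normW1_eq, eLpNorm_congr_ae h]

theorem MemH1.memW1 {f : Space d → ℝ} (hf : MemH1 1 f) : MemW1 1 f := by
  rw [MemH1, if_neg (by simp)] at hf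
  exact hf.1

theorem MemH1.exists_memLipZero {f : Space d → ℝ} (hf : MemH1 1 f) {ε : ℝ≥0∞} (hε : 0 < ε) :
    ∃ g, MemLipZero g ∧ normW1 1 (fun x => f x - g x) ≤ ε := by
  rw [MemH1, if_neg (by simp)] at hf
  exact hf.2 ε hε

/-- `H¹₁(X)` contains `f` as soon as `f ∈ W¹₁(Ω)` differs from an element of `H¹₁(X)` by a bounded
Lipschitz function. -/
theorem MemW1.memH1_of_ae_eq_add {f b w : Space d → ℝ} {K B : ℝ≥0} (hf : MemW1 1 f)
    (hb : MemH1 1 b) (hw : LipschitzWith K w) (hB : ∀ x, |w x| ≤ B)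
    (h : f =ᵐ[coneMeasure d] fun x => b x + w x) : MemH1 1 f := by
  rw [MemH1, if_neg (by simp)]
  refine ⟨hf, fun ε hε => ?_⟩
  obtain ⟨hbm, G₀, hG₀, hG₀m⟩ := hb.memW1
  obtain ⟨hfm, G, hG, hGm⟩ := hf
  have hwg := hasWeakGradient_gradient hw
  have hwi : MemLp w 1 (coneMeasure d) := (hfm.sub hbm).ae_eq (by
    filter_upwards [h] with x hx
    rw [Pi.sub_apply, hx, add_sub_cancel_left])
  have hwgi : MemLp (gradient w) 1 (coneMeasure d) := (hGm.sub hG₀m).ae_eq (by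
    filter_upwards [hG.unique ((hG₀.add hwg).congr h.symm .rfl)] with x hx
    rw [Pi.sub_apply, hx, add_sub_cancel_left])
  have hε2 : 0 < ε / 2 := ENNReal.half_pos hε.ne'
  obtain ⟨g₁, hg₁, hn₁⟩ := hb.exists_memLipZero hε2
  obtain ⟨g₂, hg₂, hn₂⟩ := exists_memLipZero_normW1_sub_le hw hB hwi.2.ne hwgi.2.ne hε2
  obtain ⟨H₁, hH₁⟩ := hg₁.1.exists_hasWeakGradient
  obtain ⟨H₂, hH₂⟩ := hg₂.1.exists_hasWeakGradient
  refine ⟨_, hg₁.add hg₂, ?_⟩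
  rw [normW1_congr (g := fun x => (b x - g₁ x) + (w x - g₂ x)) (hG.sub (hH₁.add hH₂)) (by
    filter_upwards [h] with x hx
    rw [hx]; ring)]
  exact (normW1_add_le (hG₀.sub hH₁) (hwg.sub hH₂)).trans
    ((add_le_add hn₁ hn₂).trans_eq (ENNReal.add_halves ε))

theorem MemH1.exists_lipschitzWith {f : Space d → ℝ} (hf : MemH1 ⊤ f) :
    ∃ (K B : ℝ≥0) (g : Space d → ℝ), LipschitzWith K g ∧ (∀ x, |g x| ≤ B) ∧
      f =ᵐ[coneMeasure d] g := by
  rw [MemH1, if_pos rfl] at hf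
  obtain ⟨g, hfg, hg, B, hB⟩ := hf
  obtain ⟨K, g', hg', hgg'⟩ := hg.exists_extension
  refine ⟨K, B.toNNReal, fun x => max (-B.toNNReal) (min B.toNNReal (g' x)),
    (hg'.const_min _).const_max _, fun x => ?_, ?_⟩
  · have : (0 : ℝ) ≤ B.toNNReal := NNReal.coe_nonneg _
    exact abs_le.2 ⟨le_max_left _ _, max_le (by linarith) (min_le_left _ _)⟩
  · filter_upwards [hfg, ae_mem_doubleCone] with x hx hxΩ
    have hxX := doubleCone_subset_closedDoubleCone hxΩ
    have hb := abs_le.1 ((hB x hxX).trans (Real.le_coe_toNNReal B))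
    rw [hx, hgg' hxX]
    rw [hgg' hxX] at hb
    rw [min_eq_right hb.2, max_eq_right hb.1]

/-! ### The decomposition of a function at a given height -/

theorem setLIntegral_closedBall_le_of_notMem_maximalSet {G : Space d → Space d} {l : ℝ}
    (hl : 0 ≤ l) {x : Space d}
    (hx : x ∉ maximalSet volume ((doubleCone d).indicator fun w => ‖G w‖ₑ - ENNReal.ofReal l)
      (ENNReal.ofReal l)) (r : ℝ) (hr : 0 < r) :
    ∫⁻ w in Metric.closedBall x r, (doubleCone d).indicator (‖G ·‖ₑ) w
      ≤ ENNReal.ofReal (2 * l) * volume (Metric.closedBall x r) := by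
  have h : ∫⁻ w in Metric.closedBall x r,
      (doubleCone d).indicator (fun w => ‖G w‖ₑ - ENNReal.ofReal l) w
      ≤ ENNReal.ofReal l * volume (Metric.closedBall x r) := by
    by_contra! hlt
    exact hx ⟨r, hr, hlt⟩
  calc _ ≤ ∫⁻ w in Metric.closedBall x r,
        ((doubleCone d).indicator (fun w => ‖G w‖ₑ - ENNReal.ofReal l) w + ENNReal.ofReal l) := by
        refine lintegral_mono fun w => ?_
        by_cases hw : w ∈ doubleCone d
        · simp only [indicator_of_mem hw]; exact le_tsub_add
        · simp [indicator_of_notMem hw]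
    _ = (∫⁻ w in Metric.closedBall x r,
        (doubleCone d).indicator (fun w => ‖G w‖ₑ - ENNReal.ofReal l) w)
          + ENNReal.ofReal l * volume (Metric.closedBall x r) := by
        rw [lintegral_add_right _ measurable_const, setLIntegral_const]
    _ ≤ ENNReal.ofReal l * volume (Metric.closedBall x r)
          + ENNReal.ofReal l * volume (Metric.closedBall x r) := by gcongr
    _ = _ := by rw [two_mul, ENNReal.ofReal_add hl hl, add_mul]

/-- The Lebesgue points of `f` in the cone at which `|f|`, `|f| / r` and the maximal function of
`(|G| - l)₊` are at most `l`. -/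
def goodSet (f : Space d → ℝ) (G : Space d → Space d) (l : ℝ) : Set (Space d) :=
  {x | x ∈ doubleCone d ∧ IsLebesguePoint f x ∧ |f x| ≤ l ∧ |f x| ≤ l * ‖x‖ ∧
    x ∉ maximalSet volume ((doubleCone d).indicator fun w => ‖G w‖ₑ - ENNReal.ofReal l)
      (ENNReal.ofReal l)}

/-- The Lipschitz constant on the good set, relative to the height. -/
def lipConst (d : ℕ) : ℕ := 4 * (d + 1) * 3 ^ (d + 2) * 4 ^ (d + 1)

theorem two_le_lipConst (d : ℕ) : 2 ≤ lipConst d := by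
  have h1 : 1 ≤ (d + 1) * 3 ^ (d + 2) * 4 ^ (d + 1) := Nat.one_le_iff_ne_zero.2 (by positivity)
  calc 2 ≤ 4 * 1 := by norm_num
    _ ≤ 4 * ((d + 1) * 3 ^ (d + 2) * 4 ^ (d + 1)) := Nat.mul_le_mul_left _ h1
    _ = _ := by rw [lipConst]; ring

/-- On the good set, points in one half of the cone are compared by the mean value estimate, and
points in different halves through the vertex, where `|f| ≤ l r` forces `f` to vanish. -/
theorem HasWeakGradient.abs_sub_le_of_mem_goodSet {f : Space d → ℝ} {G : Space d → Space d}
    (h : HasWeakGradient f G) (hu : LocallyIntegrable ((doubleCone d).indicator f) volume)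
    {l : ℝ} (hl : 0 ≤ l) {x y : Space d} (hx : x ∈ goodSet f G l) (hy : y ∈ goodSet f G l) :
    |f x - f y| ≤ lipConst d * l * ‖x - y‖ := by
  have hsame {σ : ℝ} (hσ : σ ^ 2 = 1) (hxσ : x ∈ halfCone d σ) (hyσ : y ∈ halfCone d σ) :
      |f x - f y| ≤ lipConst d * l * ‖x - y‖ := by
    refine (h.abs_sub_le_mul_norm_sub hu hσ (by positivity : 0 ≤ 2 * l) hxσ hyσ hx.2.1 hy.2.1
      (setLIntegral_closedBall_le_of_notMem_maximalSet hl hx.2.2.2.2)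
      (setLIntegral_closedBall_le_of_notMem_maximalSet hl hy.2.2.2.2)).trans (le_of_eq ?_)
    rw [lipConst]; push_cast; ring
  have hdiff (hn : ‖x‖ + ‖y‖ ≤ 2 * ‖x - y‖) : |f x - f y| ≤ lipConst d * l * ‖x - y‖ := by
    calc |f x - f y| ≤ |f x| + |f y| := abs_sub _ _
      _ ≤ l * ‖x‖ + l * ‖y‖ := add_le_add hx.2.2.2.1 hy.2.2.2.1
      _ = l * (‖x‖ + ‖y‖) := by ring
      _ ≤ l * (2 * ‖x - y‖) := by gcongr
      _ = 2 * l * ‖x - y‖ := by ring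
      _ ≤ _ := by
        gcongr
        exact_mod_cast two_le_lipConst d
  rcases mem_halfCone_or hx.1 with hx1 | hx1 <;> rcases mem_halfCone_or hy.1 with hy1 | hy1
  · exact hsame (by norm_num) hx1 hy1
  · exact hdiff (norm_add_norm_le_of_mem_halfCone hx1 hy1)
  · refine hdiff ?_
    have := norm_add_norm_le_of_mem_halfCone hy1 hx1
    rw [norm_sub_rev]; linarith
  · exact hsame (by norm_num) hx1 hy1

theorem exists_lipschitzWith_eqOn_goodSet {f : Space d → ℝ} {G : Space d → Space d}
    (h : HasWeakGradient f G) (hu : LocallyIntegrable ((doubleCone d).indicator f) volume)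
    {l : ℝ} (hl : 0 ≤ l) :
    ∃ g : Space d → ℝ, LipschitzWith (lipConst d * l.toNNReal) g ∧ EqOn f g (goodSet f G l) ∧
      (∀ x, |g x| ≤ l) ∧ ∀ x, |g x| ≤ l * ‖x‖ := by
  set K : ℝ≥0 := lipConst d * l.toNNReal with hK
  have hlip : LipschitzOnWith K f (goodSet f G l) := by
    refine LipschitzOnWith.of_dist_le_mul fun x hx y hy => ?_
    rw [Real.dist_eq, dist_eq_norm, hK, NNReal.coe_mul, NNReal.coe_natCast, Real.coe_toNNReal _ hl]
    exact h.abs_sub_le_of_mem_goodSet hu hl hx hy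
  obtain ⟨e, he, hfe⟩ := hlip.extend_real
  have hlK : l.toNNReal ≤ K := by
    have : (1 : ℝ≥0) ≤ lipConst d := by exact_mod_cast (two_le_lipConst d).trans' one_le_two
    exact le_mul_of_one_le_left' this
  -- The extension is truncated at the height `m = l min(1, r)`.
  set m : Space d → ℝ := fun x => min l (l * ‖x‖) with hm
  have hm0 (x : Space d) : 0 ≤ m x := le_min hl (by positivity)
  have hmlip : LipschitzWith K m := by
    refine LipschitzWith.const_min (LipschitzWith.weaken ?_ hlK) l
    refine LipschitzWith.of_dist_le_mul fun x y => ?_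
    rw [Real.dist_eq, ← mul_sub, abs_mul, abs_of_nonneg hl, Real.coe_toNNReal _ hl, dist_eq_norm]
    gcongr
    exact abs_norm_sub_norm_le x y
  have hg (x : Space d) : |max (-m x) (min (m x) (e x))| ≤ m x :=
    abs_le.2 ⟨le_max_left _ _, max_le (by linarith [hm0 x]) (min_le_left _ _)⟩
  refine ⟨fun x => max (-m x) (min (m x) (e x)), ?_, fun x hx => ?_,
    fun x => (hg x).trans (min_le_left _ _), fun x => (hg x).trans (min_le_right _ _)⟩
  · simpa using hmlip.neg.max (hmlip.min he)
  · have hb : |f x| ≤ m x := le_min hx.2.2.1 hx.2.2.2.1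
    rw [hfe hx] at hb ⊢
    have := abs_le.1 hb
    simp only
    rw [min_eq_right this.2, max_eq_right this.1]

theorem memTildeH1_top_of_lipschitzWith {K : ℝ≥0} {g : Space d → ℝ} {l : ℝ}
    (hg : LipschitzWith K g) (h1 : ∀ x, |g x| ≤ l) (h2 : ∀ x, |g x| ≤ l * ‖x‖) :
    MemTildeH1 ⊤ g ∧ normTildeH1 ⊤ g
      ≤ ENNReal.ofReal l + (K : ℝ≥0∞) + ENNReal.ofReal l := by
  have hl : 0 ≤ l := (abs_nonneg _).trans (h1 0)
  have hq (x : Space d) : ‖g x / ‖x‖‖ ≤ l := by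
    rw [norm_div, norm_norm]
    exact div_le_of_le_mul₀ (norm_nonneg _) hl (h2 x)
  refine ⟨⟨?_, ?_⟩, ?_⟩
  · rw [MemH1, if_pos rfl]
    exact ⟨g, .rfl, hg.lipschitzOnCone, l, fun x _ => h1 x⟩
  · refine memLp_top_of_bound ?_ l (ae_of_all _ hq)
    have := hg.continuous.measurable
    exact (by fun_prop : Measurable fun x => g x / ‖x‖).aestronglyMeasurable
  · rw [(hasWeakGradient_gradient hg).normTildeH1_eq]
    simp only [eLpNorm_exponent_top]
    refine add_le_add (add_le_add ?_ ?_) ?_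
    · exact eLpNormEssSup_le_of_ae_bound (ae_of_all _ h1)
    · rw [← ENNReal.ofReal_coe_nnreal]
      exact eLpNormEssSup_le_of_ae_bound (ae_of_all _ (norm_gradient_le hg))
    · exact eLpNormEssSup_le_of_ae_bound (ae_of_all _ hq)

theorem locallyIntegrable_indicator_of_ae_eq_add {f b g : Space d → ℝ}
    (hb : Integrable b (coneMeasure d)) (hg : Continuous g)
    (h : f =ᵐ[coneMeasure d] fun x => b x + g x) :
    LocallyIntegrable ((doubleCone d).indicator f) volume := by
  have h1 : LocallyIntegrable ((doubleCone d).indicator b) volume :=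
    ((integrable_indicator_iff measurableSet_doubleCone).2 hb).locallyIntegrable
  have h2 : LocallyIntegrable ((doubleCone d).indicator g) volume :=
    hg.locallyIntegrable.indicator measurableSet_doubleCone
  refine (h1.add h2).congr ?_
  rw [coneMeasure, Filter.EventuallyEq, ae_restrict_iff' measurableSet_doubleCone] at h
  filter_upwards [h] with x hx
  by_cases hxΩ : x ∈ doubleCone d
  · simp [hxΩ, hx hxΩ]
  · simp [hxΩ]

/-- The measure of the bad set, relative to `t`. -/
def badConst (d : ℕ) : ℕ := 2 + 4 ^ (d + 1)

/-- The bad set has measure at most a multiple of `t`, by the weak type inequality. -/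
theorem exists_measurableSet_ae_mem_or_mem_goodSet {f : Space d → ℝ} {G : Space d → Space d}
    (h : HasWeakGradient f G) (hu : LocallyIntegrable ((doubleCone d).indicator f) volume)
    {t l : ℝ} (ht : 0 < t) (hl : 0 < l)
    (h1 : maximalRearrangement (coneMeasure d) f t < ENNReal.ofReal l)
    (h2 : maximalRearrangement (coneMeasure d) (fun x => |f x| / ‖x‖) t < ENNReal.ofReal l)
    (h3 : maximalRearrangement (coneMeasure d) (fun x => ‖G x‖) t < ENNReal.ofReal l) :
    ∃ V, MeasurableSet V ∧ coneMeasure d V ≤ badConst d * ENNReal.ofReal t ∧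
      ∀ᵐ x ∂coneMeasure d, x ∈ V ∨ x ∈ goodSet f G l := by
  set F : Space d → ℝ≥0∞ := (doubleCone d).indicator fun w => ‖G w‖ₑ - ENNReal.ofReal l with hF
  have hl0 : ENNReal.ofReal l ≠ 0 := by simpa using hl
  have hFi : ∫⁻ x, F x ≤ ENNReal.ofReal t * ENNReal.ofReal l := by
    have hGm : AEMeasurable (fun x => ‖G x‖) (coneMeasure d) :=
      h.2.aestronglyMeasurable.norm.aemeasurable
    have := lintegral_enorm_sub_le_of_maximalRearrangement_lt ht hl hGm h3
    rw [hF, lintegral_indicator measurableSet_doubleCone]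
    simp only [enorm_norm] at this
    exact this
  have hM : volume (maximalSet volume F (ENNReal.ofReal l)) ≤ 4 ^ (d + 1) * ENNReal.ofReal t := by
    have h4 := mul_measure_maximalSet_le volume
      (hFi.trans_lt (by finiteness)).ne hl0 ENNReal.ofReal_ne_top
    rw [finrank_euclideanSpace, Fintype.card_fin] at h4
    rw [← ENNReal.mul_le_mul_iff_right hl0 ENNReal.ofReal_ne_top]
    calc _ ≤ _ := h4
      _ ≤ 4 ^ (d + 1) * (ENNReal.ofReal t * ENNReal.ofReal l) := by gcongr
      _ = _ := by ring
  set V₀ : Set (Space d) := {x | ENNReal.ofReal l < ‖f x‖ₑ}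
    ∪ {x | ENNReal.ofReal l < ‖|f x| / ‖x‖‖ₑ} ∪ maximalSet volume F (ENNReal.ofReal l) with hV₀
  refine ⟨toMeasurable (coneMeasure d) V₀, measurableSet_toMeasurable _ _, ?_, ?_⟩
  · rw [measure_toMeasurable]
    calc coneMeasure d V₀ ≤ ENNReal.ofReal t + ENNReal.ofReal t + 4 ^ (d + 1) * ENNReal.ofReal t :=
          (measure_union_le _ _).trans (add_le_add ((measure_union_le _ _).trans (add_le_add
            (measure_lt_enorm_le_of_maximalRearrangement_lt ht h1)
            (measure_lt_enorm_le_of_maximalRearrangement_lt ht h2)))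
            ((Measure.restrict_apply_le _ _).trans hM))
      _ = _ := by rw [badConst]; push_cast; ring
  · filter_upwards [ae_isLebesguePoint hu, ae_mem_doubleCone] with x hxL hxΩ
    by_cases hxV : x ∈ V₀
    · exact Or.inl (subset_toMeasurable _ _ hxV)
    · rw [hV₀, mem_union, mem_union, not_or, not_or] at hxV
      have hx0 : 0 < ‖x‖ := by
        refine norm_pos_iff.2 fun h0 => ?_
        rw [h0] at hxΩ
        change ∑ i : Fin d, (0 : Space d) i.castSucc ^ 2 < (0 : Space d) (Fin.last d) ^ 2 at hxΩ
        simp at hxΩ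
      have e1 : ‖f x‖ₑ ≤ ENNReal.ofReal l := not_lt.1 hxV.1.1
      have e2 : ‖|f x| / ‖x‖‖ₑ ≤ ENNReal.ofReal l := not_lt.1 hxV.1.2
      rw [Real.enorm_eq_ofReal_abs, ENNReal.ofReal_le_ofReal_iff hl.le] at e1
      rw [Real.enorm_of_nonneg (by positivity), ENNReal.ofReal_le_ofReal_iff hl.le,
        div_le_iff₀ hx0] at e2
      exact Or.inr ⟨hxΩ, hxL, e1, e2, hxV.2⟩

theorem eLpNorm_one_le_of_ae_le_indicator {α E : Type*} [MeasurableSpace α]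
    [NormedAddCommGroup E] {μ : Measure α} [SFinite μ] {u : α → E} {g : α → ℝ} {t l : ℝ}
    (ht : 0 < t) (hl : 0 < l) (hg : AEMeasurable g μ)
    (h : maximalRearrangement μ g t < ENNReal.ofReal l) {V : Set α} (hVm : MeasurableSet V)
    {c k : ℕ} (hV : μ V ≤ c * ENNReal.ofReal t)
    (hu : ∀ᵐ x ∂μ, ‖u x‖ₑ ≤ V.indicator (fun x => ‖g x‖ₑ + k * ENNReal.ofReal l) x) :
    eLpNorm u 1 μ ≤ (1 + c + k * c : ℕ) * (ENNReal.ofReal t * ENNReal.ofReal l) := by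
  rw [eLpNorm_one_eq_lintegral_enorm]
  calc ∫⁻ x, ‖u x‖ₑ ∂μ ≤ ∫⁻ x, V.indicator (fun x => ‖g x‖ₑ + k * ENNReal.ofReal l) x ∂μ :=
        lintegral_mono_ae hu
    _ = ∫⁻ x in V, ‖g x‖ₑ ∂μ + k * ENNReal.ofReal l * μ V := by
        rw [lintegral_indicator hVm, lintegral_add_right _ measurable_const, setLIntegral_const]
    _ ≤ (1 + c) * (ENNReal.ofReal t * ENNReal.ofReal l)
          + k * ENNReal.ofReal l * (c * ENNReal.ofReal t) := by
        gcongr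
        exact setLIntegral_enorm_le_of_maximalRearrangement_lt ht hl hg h hV
    _ = _ := by push_cast; ring

/-- The constant in the upper bound for the `K`-functional. -/
def upperConst (d : ℕ) : ℕ := (1 + badConst d) * (5 + lipConst d)

/-- The upper bound for the `K`-functional, with any height `l` exceeding the three maximal
rearrangements. The function `f₁` agrees with `f` on the good set, so that `f₀ = f - f₁` and its
gradient live on the bad set. -/
theorem kFunctionalTildeH1_le_of_maximalRearrangement_lt {f : Space d → ℝ} (hf : MemSumTildeH1 f)
    {t l : ℝ} (ht : 0 < t) (hl : 0 < l)
    (h1 : maximalRearrangement (coneMeasure d) f t < ENNReal.ofReal l)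
    (h2 : maximalRearrangement (coneMeasure d) (fun x => |f x| / ‖x‖) t < ENNReal.ofReal l)
    (h3 : maximalRearrangement (coneMeasure d) (fun x => ‖weakGradient f x‖) t
      < ENNReal.ofReal l) :
    kFunctionalTildeH1 f t ≤ upperConst d * (ENNReal.ofReal t * ENNReal.ofReal l) := by
  obtain ⟨b₀, b₁, hb₀, hb₁, hfb⟩ := hf
  obtain ⟨K₁, B₁, g₁, hg₁, hB₁, hbg⟩ := hb₁.1.exists_lipschitzWith
  replace hfb : f =ᵐ[coneMeasure d] fun x => b₀ x + g₁ x := by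
    filter_upwards [hfb, hbg] with x hx hx'
    rw [hx, hx']
  obtain ⟨hb₀m, G₀, hG₀, -⟩ := hb₀.1.memW1
  have hG : HasWeakGradient f (weakGradient f) :=
    ((hG₀.add (hasWeakGradient_gradient hg₁)).congr hfb.symm .rfl).weakGradient_spec
  set G := weakGradient f with hGdef
  have hu := locallyIntegrable_indicator_of_ae_eq_add (memLp_one_iff_integrable.1 hb₀m)
    hg₁.continuous hfb
  obtain ⟨f₁, hf₁, hff₁, hf₁l, hf₁r⟩ := exists_lipschitzWith_eqOn_goodSet hG hu hl.le
  obtain ⟨V, hVm, hV, hVae⟩ := exists_measurableSet_ae_mem_or_mem_goodSet hG hu ht hl h1 h2 h3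
  obtain ⟨hf₁m, hf₁n⟩ := memTildeH1_top_of_lipschitzWith hf₁ hf₁l hf₁r
  set f₀ : Space d → ℝ := fun x => f x - f₁ x with hf₀
  have hwG := hG.sub (hasWeakGradient_gradient hf₁)
  have hfm : AEMeasurable f (coneMeasure d) := hG.1.aestronglyMeasurable.aemeasurable
  have hGm : AEMeasurable (fun x => ‖G x‖) (coneMeasure d) :=
    hG.2.aestronglyMeasurable.norm.aemeasurable
  have hw : LipschitzWith _ fun x => g₁ x - f₁ x := hg₁.sub hf₁
  have hzero := hwG.ae_eq_zero_of_eq_zero fun ε hε => by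
    obtain ⟨g, hg, hgn⟩ := hb₀.1.exists_memLipZero hε
    obtain ⟨L, hL⟩ := hg.1
    obtain ⟨H, hH⟩ := hg.1.exists_hasWeakGradient
    refine ⟨fun x => g x + (g₁ x - f₁ x), ?_, ?_⟩
    · obtain ⟨L', hL'⟩ := hw.lipschitzOnCone
      exact ⟨L + L', hL.add hL'⟩
    · refine le_trans (le_of_eq (normW1_congr (hwG.sub (hH.add (hasWeakGradient_gradient hw))) ?_))
        hgn
      filter_upwards [hfb] with x hx
      rw [hx]; ring
  have hgood : ∀ᵐ x ∂coneMeasure d, x ∈ V ∨ (f₀ x = 0 ∧ G x - gradient f₁ x = 0) := by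
    filter_upwards [hVae, hzero] with x hx hx0
    refine hx.imp_right fun hxg => ?_
    have : f x - f₁ x = 0 := sub_eq_zero.2 (hff₁ hxg)
    exact ⟨this, hx0 this⟩
  have n1 : eLpNorm f₀ 1 (coneMeasure d) ≤ _ :=
    eLpNorm_one_le_of_ae_le_indicator ht hl hfm h1 hVm hV (k := 1) (by
      filter_upwards [hgood] with x hx
      by_cases hxV : x ∈ V
      · rw [indicator_of_mem hxV, Nat.cast_one, one_mul]
        refine enorm_sub_le.trans ?_
        gcongr
        rw [Real.enorm_eq_ofReal_abs]
        exact ENNReal.ofReal_le_ofReal (hf₁l x)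
      · simp [(hx.resolve_left hxV).1])
  have n2 : eLpNorm (fun x => f₀ x / ‖x‖) 1 (coneMeasure d) ≤ _ :=
    eLpNorm_one_le_of_ae_le_indicator ht hl
      (by fun_prop : AEMeasurable (fun x => |f x| / ‖x‖) (coneMeasure d)) h2 hVm hV (k := 1) (by
      filter_upwards [hgood] with x hx
      by_cases hxV : x ∈ V
      · rw [indicator_of_mem hxV, Nat.cast_one, one_mul, hf₀, sub_div]
        refine enorm_sub_le.trans ?_
        gcongr
        · rw [enorm_le_iff_norm_le]; simp
        · rw [← ofReal_norm, norm_div, norm_norm]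
          exact ENNReal.ofReal_le_ofReal (div_le_of_le_mul₀ (norm_nonneg _) hl.le (hf₁r x))
      · simp [(hx.resolve_left hxV).1])
  have n3 : eLpNorm (fun x => G x - gradient f₁ x) 1 (coneMeasure d) ≤ _ :=
    eLpNorm_one_le_of_ae_le_indicator ht hl hGm h3 hVm hV (k := lipConst d) (by
      filter_upwards [hgood] with x hx
      by_cases hxV : x ∈ V
      · rw [indicator_of_mem hxV, enorm_norm]
        refine enorm_sub_le.trans ?_
        gcongr
        have := norm_gradient_le hf₁ x
        rw [NNReal.coe_mul, NNReal.coe_natCast, Real.coe_toNNReal _ hl.le] at this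
        rw [← ofReal_norm, ← ENNReal.ofReal_natCast, ← ENNReal.ofReal_mul (by positivity)]
        exact ENNReal.ofReal_le_ofReal this
      · rw [(hx.resolve_left hxV).2]; simp)
  have hfin (N : ℕ) : (N : ℝ≥0∞) * (ENNReal.ofReal t * ENNReal.ofReal l) < ⊤ := by finiteness
  have hf₀W : MemW1 1 f₀ := ⟨⟨hwG.1.aestronglyMeasurable, n1.trans_lt (hfin _)⟩, _, hwG,
    hwG.2.aestronglyMeasurable, n3.trans_lt (hfin _)⟩
  have hwB (x : Space d) : |g₁ x - f₁ x| ≤ (B₁ + l.toNNReal : ℝ≥0) := by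
    rw [NNReal.coe_add, Real.coe_toNNReal _ hl.le]
    exact (abs_sub _ _).trans (add_le_add (hB₁ x) (hf₁l x))
  have hf₀H : MemH1 1 f₀ := hf₀W.memH1_of_ae_eq_add hb₀.1 hw hwB (by
    filter_upwards [hfb] with x hx
    rw [hf₀]; simp only; rw [hx]; ring)
  have hf₀T : MemTildeH1 1 f₀ := ⟨hf₀H, by
    have := hf₁.continuous.measurable
    exact (by fun_prop : AEMeasurable (fun x => (f x - f₁ x) / ‖x‖)
      (coneMeasure d)).aestronglyMeasurable, n2.trans_lt (hfin _)⟩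
  have hsum : f =ᵐ[coneMeasure d] fun x => f₀ x + f₁ x :=
    Eventually.of_forall fun x => (sub_add_cancel (f x) (f₁ x)).symm
  have hK : kFunctionalTildeH1 f t ≤ normTildeH1 1 f₀ + ENNReal.ofReal t * normTildeH1 ⊤ f₁ := by
    unfold kFunctionalTildeH1
    exact iInf_le_of_le f₀ (iInf_le_of_le f₁ (iInf_le_of_le hf₀T (iInf_le_of_le hf₁m
      (iInf_le_of_le hsum le_rfl))))
  refine hK.trans ?_
  rw [hwG.normTildeH1_eq]
  calc _ ≤ _ := add_le_add (add_le_add (add_le_add n1 n3) n2) (mul_le_mul_right hf₁n _)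
    _ = _ := by
      rw [upperConst, ENNReal.coe_mul, ENNReal.coe_natCast]
      change _ + ENNReal.ofReal t * (_ + _ * ENNReal.ofReal l + _) = _
      push_cast
      ring

theorem kFunctionalTildeH1_le {f : Space d → ℝ} (hf : MemSumTildeH1 f) {t : ℝ} (ht : 0 < t) :
    kFunctionalTildeH1 f t ≤ upperConst d * (ENNReal.ofReal t *
      (maximalRearrangement (coneMeasure d) f t
        + maximalRearrangement (coneMeasure d) (fun x => |f x| / ‖x‖) t
        + maximalRearrangement (coneMeasure d) (fun x => ‖weakGradient f x‖) t)) := by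
  set A := maximalRearrangement (coneMeasure d) f t
        + maximalRearrangement (coneMeasure d) (fun x => |f x| / ‖x‖) t
        + maximalRearrangement (coneMeasure d) (fun x => ‖weakGradient f x‖) t with hA
  have ht0 : ENNReal.ofReal t ≠ 0 := by simpa using ht
  have hC0 : (upperConst d : ℝ≥0∞) ≠ 0 := by
    rw [upperConst]; positivity
  rcases eq_or_ne A ⊤ with h | h
  · rw [h, ENNReal.mul_top ht0, ENNReal.mul_top hC0]
    exact le_top
  · have hne : (𝓝[>] A).NeBot := nhdsGT_neBot_of_exists_gt ⟨⊤, h.lt_top⟩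
    have hlim : Tendsto (fun b => (upperConst d : ℝ≥0∞) * (ENNReal.ofReal t * b)) (𝓝[>] A)
        (𝓝 (upperConst d * (ENNReal.ofReal t * A))) :=
      ((ENNReal.continuous_const_mul (by finiteness)).comp
        (ENNReal.continuous_const_mul (by finiteness))).continuousAt.tendsto.mono_left
          nhdsWithin_le_nhds
    refine ge_of_tendsto hlim ?_
    filter_upwards [self_mem_nhdsWithin] with b (hb : A < b)
    rcases eq_or_ne b ⊤ with rfl | hbt
    · rw [ENNReal.mul_top ht0, ENNReal.mul_top hC0]
      exact le_top
    · have hb0 : 0 < b.toReal := ENNReal.toReal_pos (zero_le.trans_lt hb).ne' hbt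
      rw [← ENNReal.ofReal_toReal hbt] at hb ⊢
      exact kFunctionalTildeH1_le_of_maximalRearrangement_lt hf ht hb0
        ((le_self_add.trans le_self_add).trans_lt hb)
        ((le_add_self.trans le_self_add).trans_lt hb) (le_add_self.trans_lt hb)

end

theorem theorem4p2 (d : ℕ) (hd : 1 ≤ d) :
    ∃ c C : ℝ, 0 < c ∧ 0 < C ∧
      ∀ f : EuclideanSpace ℝ (Fin (d + 1)) → ℝ, MemSumTildeH1 f → ∀ t : ℝ, 0 < t →
        ENNReal.ofReal c * (ENNReal.ofReal t *
            (maximalRearrangement (coneMeasure d) f t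
              + maximalRearrangement (coneMeasure d) (fun x => |f x| / ‖x‖) t
              + maximalRearrangement (coneMeasure d) (fun x => ‖weakGradient f x‖) t))
          ≤ kFunctionalTildeH1 f t ∧
        kFunctionalTildeH1 f t
          ≤ ENNReal.ofReal C * (ENNReal.ofReal t *
            (maximalRearrangement (coneMeasure d) f t
              + maximalRearrangement (coneMeasure d) (fun x => |f x| / ‖x‖) t
              + maximalRearrangement (coneMeasure d) (fun x => ‖weakGradient f x‖) t)) := by
  have hC : 0 < upperConst d := by rw [upperConst]; positivity
  refine ⟨1, upperConst d, one_pos, by exact_mod_cast hC, fun f hf t ht => ⟨?_, ?_⟩⟩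
  · rw [ENNReal.ofReal_one, one_mul]
    exact ofReal_mul_sum_maximalRearrangement_le_kFunctionalTildeH1 f ht
  · rw [ENNReal.ofReal_natCast]
    exact kFunctionalTildeH1_le hf ht
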